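/- Let $q_0>0$, let $\alpha,\theta_+,\theta_-$ be real with $\theta_++\theta_-=0$ (modulo $2\pi$), put $q_\pm(t)=q_0e^{i(\alpha t+\theta_\pm)}$, and let $q:\mathbb{R}\times\mathbb{R}\to\mathbb{C}$. For a fixed time $t\in\mathbb R$ consider the scattering problem $$v_x=(ikJ+Q)v,\quad x\in\mathbb{R},\qquad J=\begin{pmatrix}-1&0\\0&1\end{pmatrix},\quad Q=\begin{pmatrix}0&q(x,t)\\q(-x,-t)&0\end{pmatrix},$$ whose solutions are the locally absolutely continuous functions satisfying the equation for almost every $x$, and put $$Q_\pm=\begin{pmatrix}0&q_\pm(t)\\q_\mp(-t)&0\end{pmatrix}.$$ Let $\mathbb{K}$ be the Riemann surface of $\lambda^2=k^2-q_0^2$. Write $k-q_0=r_1e^{i\theta_1}$ with $0\le\theta_1<2\pi$ and $k+q_0=r_2e^{i\theta_2}$ with $-\pi\le\theta_2<\pi$. The open upper sheet $\mathbb{C}_1$ and the open lower sheet $\mathbb{C}_2$ are two copies of the plane cut along $(-\infty,-q_0]\cup[q_0,\infty)$, on which $\lambda=(r_1r_2)^{1/2}e^{i(\theta_1+\theta_2)/2}$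 and $\lambda=-(r_1r_2)^{1/2}e^{i(\theta_1+\theta_2)/2}$ respectively; thus $\operatorname{Im}\lambda>0$ on $\mathbb{C}_1$ and $\operatorname{Im}\lambda<0$ on $\mathbb{C}_2$. Their closures $\overline{\mathbb{C}}_1,\overline{\mathbb{C}}_2$ in $\mathbb{K}$ contain both edges of the cut and the branch points $k=\pm q_0$. Points of $\mathbb K$ are denoted by $k$, with $\lambda=\lambda(k)$. The Jost eigenfunctions are $M=e^{i\lambda x}\phi$, $\overline M=e^{-i\lambda x}\overline\phi$, $N=e^{-i\lambda x}\psi$ and $\overline N=e^{i\lambda x}\overline\psi$, where $\phi,\overline\phi,\psi,\overline\psi$ are the solutions of the scattering problem fixed by $$M\to\begin{pmatrix}\lambda+k\\ iq_+(-t)\end{pmatrix},\quad \overline M\to\begin{pmatrix}-iq_-(t)\\ \lambda+k\end{pmatrix}\quad(x\to-\infty),$$ $$N\to\begin{pmatrix}-iq_+(t)\\ \lambda+k\end{pmatrix},\quad \overline N\to\begin{pmatrix}\lambda+k\\ iq_-(-t)\end{pmatrix}\quad(x\to+\infty).$$ (i) Suppose that the entries of $Q-Q_-$ belong to $L^1((-\infty,0])$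 and those of $Q-Q_+$ to $L^1([0,\infty))$. Then $M$ and $N$ exist and are unique for every $k\in\overline{\mathbb{C}}_1\setminus\{\pm q_0\}$, as do and are $\overline M$ and $\overline N$ for every $k\in\overline{\mathbb{C}}_2\setminus\{\pm q_0\}$. For each $x\in\mathbb{R}$, $M(x,k)$ and $N(x,k)$ are continuous for $k\in\overline{\mathbb{C}}_1\setminus\{\pm q_0\}$ and analytic for $k\in\mathbb{C}_1$, and $\overline M(x,k)$ and $\overline N(x,k)$ are continuous for $k\in\overline{\mathbb{C}}_2\setminus\{\pm q_0\}$ and analytic for $k\in\mathbb{C}_2$. (ii) Suppose that, in addition, these entries belong to $L^{1,2}$ on the same half-lines, that is, $\int|f(x)|(1+|x|)^2\,dx<\infty$ over the half-line for each entry $f$. Then $M$ and $N$ exist and are unique for every $k\in\overline{\mathbb{C}}_1$, and $\overline M$ and $\overline N$ for every $k\in\overline{\mathbb{C}}_2$. For each $x\in\mathbb{R}$, $M(x,k)$ and $N(x,k)$ are continuous for $k\in\overline{\mathbb{C}}_1$ and analytic for $k\in\mathbb{C}_1$, and $\overline M(x,k)$ and $\overline N(x,k)$ are continuous for $k\in\overline{\mathbb{C}}_2$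 and analytic for $k\in\mathbb{C}_2$. -/

import Mathlib

open Set Filter Topology MeasureTheory
open scoped Matrix

namespace NonlocalSinhGordon

noncomputable section

/-! ### The two-sheeted surface `λ² = k² - q₀²` -/

/-- The cut `(-∞, -q₀] ∪ [q₀, ∞)` in the complex `k`-plane. -/
def cut (q₀ : ℝ) : Set ℂ := {k | k.im = 0 ∧ (k.re ≤ -q₀ ∨ q₀ ≤ k.re)}

/-- The polar angle of `z`, normalised to `[0, 2π)`. -/
def angle₁ (z : ℂ) : ℝ := if z.arg < 0 then z.arg + 2 * Real.pi else z.arg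

/-- The polar angle of `z`, normalised to `[-π, π)`. -/
def angle₂ (z : ℂ) : ℝ := if z.arg = Real.pi then -Real.pi else z.arg

/-- The branch `λ₁(k) = (r₁ r₂)^{1/2} e^{i(θ₁+θ₂)/2}` of `√(k² - q₀²)`, where
`k - q₀ = r₁ e^{iθ₁}` with `0 ≤ θ₁ < 2π` and `k + q₀ = r₂ e^{iθ₂}` with `-π ≤ θ₂ < π`. -/
def lam₁ (q₀ : ℝ) (k : ℂ) : ℂ :=
  ((Real.sqrt (‖k - q₀‖ * ‖k + q₀‖) : ℝ) : ℂ) *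
    Complex.exp (Complex.I * (((angle₁ (k - q₀) + angle₂ (k + q₀)) / 2 : ℝ) : ℂ))

/-- The branch of `√(k² - q₀²)` on the second sheet. -/
def lam₂ (q₀ : ℝ) (k : ℂ) : ℂ := -lam₁ q₀ k

/-- The open upper sheet `ℂ₁`, as a set of points `(k, λ)` of the curve `λ² = k² - q₀²`:
the cut plane with `λ = λ₁(k)`. -/
def upperSheet (q₀ : ℝ) : Set (ℂ × ℂ) := (fun k => (k, lam₁ q₀ k)) '' (cut q₀)ᶜ

/-- The open lower sheet `ℂ₂`: the cut plane with `λ = λ₂(k)`. -/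
def lowerSheet (q₀ : ℝ) : Set (ℂ × ℂ) := (fun k => (k, lam₂ q₀ k)) '' (cut q₀)ᶜ

/-- The closed upper sheet: the closure in the (closed) curve `λ² = k² - q₀²`. It adds to the open
sheet both edges of the cut (over each `k` in the interior of the cut the two points `(k, ±λ)`,
with `λ` real) and the two branch points. -/
def closedUpperSheet (q₀ : ℝ) : Set (ℂ × ℂ) := closure (upperSheet q₀)

/-- The closed lower sheet. -/
def closedLowerSheet (q₀ : ℝ) : Set (ℂ × ℂ) := closure (lowerSheet q₀)

/-- The branch points `k = ±q₀` (where `λ = 0`). -/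
def branchPoints (q₀ : ℝ) : Set (ℂ × ℂ) := {((q₀ : ℂ), 0), (-(q₀ : ℂ), 0)}

/-! ### The scattering problem -/

/-- The boundary value `q₀ e^{i(αt+θ)}` of the potential: `q_±(t)` for `θ = θ_±`. -/
def qInf (q₀ α θ t : ℝ) : ℂ := (q₀ : ℂ) * Complex.exp (Complex.I * ((α * t + θ : ℝ) : ℂ))

/-- `J = diag(-1, 1)`. -/
def J : Matrix (Fin 2) (Fin 2) ℂ := !![-1, 0; 0, 1]

/-- The potential matrix `Q`, with entries `q(x,t)` and `q(-x,-t)` off the diagonal. -/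
def Q (q : ℝ → ℝ → ℂ) (t x : ℝ) : Matrix (Fin 2) (Fin 2) ℂ := !![0, q x t; q (-x) (-t), 0]

/-- `Q_+(t)`, the limit of `Q` as `x → +∞`. -/
def Qplus (q₀ α θp θm t : ℝ) : Matrix (Fin 2) (Fin 2) ℂ :=
  !![0, qInf q₀ α θp t; qInf q₀ α θm (-t), 0]

/-- `Q_-(t)`, the limit of `Q` as `x → -∞`. -/
def Qminus (q₀ α θp θm t : ℝ) : Matrix (Fin 2) (Fin 2) ℂ :=
  !![0, qInf q₀ α θm t; qInf q₀ α θp (-t), 0]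

/-- `v` is a solution on `ℝ` of `v_x = (ikJ + Q)v` at the fixed time `t`. The potential is only
locally integrable, so this is meant in the sense of Carathéodory: `v` is continuous and satisfies
the integrated equation (equivalently, `v` is locally absolutely continuous and satisfies the
equation almost everywhere). -/
def IsSolution (q : ℝ → ℝ → ℂ) (t : ℝ) (k : ℂ) (v : ℝ → Fin 2 → ℂ) : Prop :=
  Continuous v ∧
    ∀ a b : ℝ,
      IntervalIntegrable (fun x => ((Complex.I * k) • J + Q q t x) *ᵥ v x) volume a b ∧
      v b - v a = ∫ x in a..b, ((Complex.I * k) • J + Q q t x) *ᵥ v x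

/-- `φ ~ w e^{-iλx}` as `x → -∞`, `w = (λ + k, i q_+)`. The second entry of `w` is `i` times the
lower left entry of `Q_-(t)`, which makes `w e^{-iλx}` a solution of `v_x = (ikJ + Q_-)v`. -/
def IsPhi (q₀ α θp : ℝ) (q : ℝ → ℝ → ℂ) (t : ℝ) (P : ℂ × ℂ) (φ : ℝ → Fin 2 → ℂ) : Prop :=
  IsSolution q t P.1 φ ∧
    Tendsto (fun x : ℝ => Complex.exp (Complex.I * P.2 * x) • φ x) atBot
      (𝓝 ![P.2 + P.1, Complex.I * qInf q₀ α θp (-t)])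

/-- `φ̄ ~ w̄ e^{iλx}` as `x → -∞`, `w̄ = (-i q_-, λ + k)`. -/
def IsPhiBar (q₀ α θm : ℝ) (q : ℝ → ℝ → ℂ) (t : ℝ) (P : ℂ × ℂ) (φ : ℝ → Fin 2 → ℂ) : Prop :=
  IsSolution q t P.1 φ ∧
    Tendsto (fun x : ℝ => Complex.exp (-(Complex.I * P.2 * x)) • φ x) atBot
      (𝓝 ![-(Complex.I * qInf q₀ α θm t), P.2 + P.1])

/-- `ψ ~ v e^{iλx}` as `x → +∞`, `v = (-i q_+, λ + k)`. -/
def IsPsi (q₀ α θp : ℝ) (q : ℝ → ℝ → ℂ) (t : ℝ) (P : ℂ × ℂ) (ψ : ℝ → Fin 2 → ℂ) : Prop :=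
  IsSolution q t P.1 ψ ∧
    Tendsto (fun x : ℝ => Complex.exp (-(Complex.I * P.2 * x)) • ψ x) atTop
      (𝓝 ![-(Complex.I * qInf q₀ α θp t), P.2 + P.1])

/-- `ψ̄ ~ v̄ e^{-iλx}` as `x → +∞`, `v̄ = (λ + k, i q_-)`; the second entry of `v̄` is `i` times the
lower left entry of `Q_+(t)`. -/
def IsPsiBar (q₀ α θm : ℝ) (q : ℝ → ℝ → ℂ) (t : ℝ) (P : ℂ × ℂ) (ψ : ℝ → Fin 2 → ℂ) : Prop :=
  IsSolution q t P.1 ψ ∧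
    Tendsto (fun x : ℝ => Complex.exp (Complex.I * P.2 * x) • ψ x) atTop
      (𝓝 ![P.2 + P.1, Complex.I * qInf q₀ α θm (-t)])

/-- `φ(·,P)`: the solution singled out by `IsPhi` (meaningful where that solution exists and is
unique; similarly below). -/
def phi (q₀ α θp : ℝ) (q : ℝ → ℝ → ℂ) (t : ℝ) (P : ℂ × ℂ) : ℝ → Fin 2 → ℂ :=
  Classical.epsilon (IsPhi q₀ α θp q t P)

def phiBar (q₀ α θm : ℝ) (q : ℝ → ℝ → ℂ) (t : ℝ) (P : ℂ × ℂ) : ℝ → Fin 2 → ℂ :=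
  Classical.epsilon (IsPhiBar q₀ α θm q t P)

def psi (q₀ α θp : ℝ) (q : ℝ → ℝ → ℂ) (t : ℝ) (P : ℂ × ℂ) : ℝ → Fin 2 → ℂ :=
  Classical.epsilon (IsPsi q₀ α θp q t P)

def psiBar (q₀ α θm : ℝ) (q : ℝ → ℝ → ℂ) (t : ℝ) (P : ℂ × ℂ) : ℝ → Fin 2 → ℂ :=
  Classical.epsilon (IsPsiBar q₀ α θm q t P)

/-- `M = e^{iλx} φ`. -/
def M (q₀ α θp : ℝ) (q : ℝ → ℝ → ℂ) (t x : ℝ) (P : ℂ × ℂ) : Fin 2 → ℂ :=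
  Complex.exp (Complex.I * P.2 * x) • phi q₀ α θp q t P x

/-- `M̄ = e^{-iλx} φ̄`. -/
def MBar (q₀ α θm : ℝ) (q : ℝ → ℝ → ℂ) (t x : ℝ) (P : ℂ × ℂ) : Fin 2 → ℂ :=
  Complex.exp (-(Complex.I * P.2 * x)) • phiBar q₀ α θm q t P x

/-- `N = e^{-iλx} ψ`. -/
def N (q₀ α θp : ℝ) (q : ℝ → ℝ → ℂ) (t x : ℝ) (P : ℂ × ℂ) : Fin 2 → ℂ :=
  Complex.exp (-(Complex.I * P.2 * x)) • psi q₀ α θp q t P x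

/-- `N̄ = e^{iλx} ψ̄`. -/
def NBar (q₀ α θm : ℝ) (q : ℝ → ℝ → ℂ) (t x : ℝ) (P : ℂ × ℂ) : Fin 2 → ℂ :=
  Complex.exp (Complex.I * P.2 * x) • psiBar q₀ α θm q t P x

/-! ### Function classes -/

/-- `f ∈ L^{1,2}(s)`: `f` is measurable on `s` and `∫_s |f(x)| (1+|x|)² dx < ∞`. -/
def MemL12On (f : ℝ → ℂ) (s : Set ℝ) : Prop :=
  AEStronglyMeasurable f (volume.restrict s) ∧
    IntegrableOn (fun x => ‖f x‖ * (1 + |x|) ^ 2) s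

/-- The entries of `Q - Q_±` are in `L¹`, each near its own end: those of `Q - Q_-` on `(-∞, 0]`
and those of `Q - Q_+` on `[0, ∞)`. -/
def PotentialL1 (q₀ α θp θm : ℝ) (q : ℝ → ℝ → ℂ) (t : ℝ) : Prop :=
  ∀ i j : Fin 2,
    IntegrableOn (fun x => (Q q t x - Qminus q₀ α θp θm t) i j) (Iic 0) ∧
    IntegrableOn (fun x => (Q q t x - Qplus q₀ α θp θm t) i j) (Ici 0)

/-- The entries of `Q - Q_±` are in `L^{1,2}`, each near its own end. -/
def PotentialL12 (q₀ α θp θm : ℝ) (q : ℝ → ℝ → ℂ) (t : ℝ) : Prop :=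
  ∀ i j : Fin 2,
    MemL12On (fun x => (Q q t x - Qminus q₀ α θp θm t) i j) (Iic 0) ∧
    MemL12On (fun x => (Q q t x - Qplus q₀ α θp θm t) i j) (Ici 0)

end

end NonlocalSinhGordon

open NonlocalSinhGordon

namespace NonlocalSinhGordon

/-! ### Holomorphy of parameter integrals -/

section HolomorphicIntegral

/-! Stripping the exponential turns the Jost problem at -∞ into m' = (E + B(x)) m, m → w, with E =
ikJ + Q_- + iλ, B = Q - Q_- and E w = 0. Since q_-(t) q_+(-t) = q₀², one has (ikJ + Q_-)² = -λ², so
E² = μE with μ = 2iλ (`limitOp_mul_self`), and e^{sE} = 1 + ((e^{μs} - 1)/μ) E, with no singularity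
at μ = 0. On the closed upper sheet Re μ ≤ 0, so for s ≥ 0 the norm of e^{sE} is at most 1 +
2‖E‖/|μ| off the branch points and at most 1 + s‖E‖ everywhere. The second bound costs a first
moment of the potential, which L^{1,2} supplies.

Variation of constants gives m(x) = w + ∫_{-∞}^x e^{(x-y)E} B(y) m(y) dy, a Volterra equation whose
kernel is dominated by an integrable h(y). In the sup norm with weight exp(-2∫_{-∞}^x h) the
integral operator has norm at most 1/2, so the Neumann series converges geometrically, uniformly
over parameters that share the majorant h. Its terms are continuous, and holomorphic off the cut,
hence so is the sum (`continuousOn_jostSol`, `differentiableOn_jostSol`).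

For uniqueness, the difference d of two solutions with the same limit tends to 0, and it solves the
homogeneous Volterra equation once e^{(x-a)E} d(a) → 0 as a → -∞. For μ ≠ 0 the propagator is
bounded. For μ = 0 the dangerous term is (x - a) E d(a); as E² = 0, E d(a) = ∫_{-∞}^a E B d, and the
first moment absorbs the factor x - a.

The remaining Jost functions follow by symmetry: λ → -λ carries the lower sheet to Im λ ≥ 0, and x →
-x together with k → -k exchanges the two ends (`IsOffDiagSolution.comp_neg`). Thus
`existsUnique_continuousOn_analyticOnNhd` is applied four times. -/

theorem differentiableOn_integral_of_dominated {V α : Type*} [NormedAddCommGroup V]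
    [NormedSpace ℂ V] [CompleteSpace V] [MeasurableSpace α] {μ : Measure α}
    {F : ℂ → α → V} {U : Set ℂ} (hU : IsOpen U) {bound : α → ℝ} (hb : Integrable bound μ)
    (hmeas : ∀ k ∈ U, AEStronglyMeasurable (F k) μ)
    (hbound : ∀ᵐ a ∂μ, ∀ k ∈ U, ‖F k a‖ ≤ bound a)
    (hdiff : ∀ᵐ a ∂μ, DifferentiableOn ℂ (fun k => F k a) U) :
    DifferentiableOn ℂ (fun k => ∫ a, F k a ∂μ) U := by
  intro k₀ hk₀
  obtain ⟨r, hr, hrU⟩ := Metric.isOpen_iff.1 hU k₀ hk₀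
  have hr2 : 0 < r / 2 := by positivity
  have hsub : ∀ k ∈ Metric.ball k₀ (r / 2), Metric.closedBall k (r / 4) ⊆ U := by
    intro k hk z hz
    apply hrU
    rw [Metric.mem_ball] at hk ⊢
    rw [Metric.mem_closedBall] at hz
    linarith [dist_triangle z k k₀]
  have hballU : Metric.ball k₀ (r / 2) ⊆ U := (Metric.ball_subset_ball (by linarith)).trans hrU
  have hderiv : ∀ᵐ a ∂μ, ∀ k ∈ Metric.ball k₀ (r / 2),
      HasDerivAt (fun k => F k a) (deriv (fun k => F k a) k) k := by
    filter_upwards [hdiff] with a ha k hk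
    exact (ha.differentiableAt (hU.mem_nhds (hballU hk))).hasDerivAt
  -- The derivative is an a.e. limit of difference quotients along a sequence of nonzero steps, each
  -- of which is measurable.
  have hmeas' : AEStronglyMeasurable (fun a => deriv (fun k => F k a) k₀) μ := by
    let s : ℕ → ℂ := fun n => ((r / 2 / ((n : ℝ) + 2) : ℝ) : ℂ)
    have hs_pos : ∀ n : ℕ, 0 < r / 2 / ((n : ℝ) + 2) := fun n => by positivity
    have hs0 : Tendsto s atTop (𝓝 0) := by
      have h1 : Tendsto (fun n : ℕ => r / 2 / ((n : ℝ) + 2)) atTop (𝓝 0) :=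
        Tendsto.div_atTop tendsto_const_nhds
          (tendsto_atTop_add_const_right _ _ tendsto_natCast_atTop_atTop)
      have h2 := (Complex.continuous_ofReal.tendsto 0).comp h1
      rwa [Complex.ofReal_zero] at h2
    have hs1 : Tendsto s atTop (𝓝[≠] 0) := by
      refine tendsto_nhdsWithin_iff.2 ⟨hs0, Eventually.of_forall fun n => ?_⟩
      simpa [s] using Complex.ofReal_ne_zero.2 (hs_pos n).ne'
    have hsU : ∀ n, k₀ + s n ∈ U := by
      intro n
      apply hrU
      rw [Metric.mem_ball, dist_eq_norm, add_sub_cancel_left, Complex.norm_real,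
        Real.norm_of_nonneg (hs_pos n).le, div_div, div_lt_iff₀ (by positivity)]
      nlinarith [Nat.cast_nonneg (α := ℝ) n]
    refine aestronglyMeasurable_of_tendsto_ae atTop
      (f := fun n a => (s n)⁻¹ • (F (k₀ + s n) a - F k₀ a)) (fun n => ?_) ?_
    · exact ((hmeas _ (hsU n)).sub (hmeas _ hk₀)).const_smul _
    · filter_upwards [hderiv] with a ha
      exact (hasDerivAt_iff_tendsto_slope_zero.1 (ha k₀ (Metric.mem_ball_self hr2))).comp hs1
  -- Cauchy's estimate on circles of radius r/4, which stay in `U` because r/2 + r/4 < r, turns the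
  -- bound on `F` into one on its derivative.
  have hbound' : ∀ᵐ a ∂μ, ∀ k ∈ Metric.ball k₀ (r / 2),
      ‖deriv (fun k => F k a) k‖ ≤ bound a / (r / 4) := by
    filter_upwards [hdiff, hbound] with a ha hba k hk
    refine Complex.norm_deriv_le_of_forall_mem_sphere_norm_le (by positivity) ?_ ?_
    · exact (ha.mono (hsub k hk)).diffContOnCl_ball subset_rfl
    · intro z hz
      exact hba z (hsub k hk (Metric.sphere_subset_closedBall hz))
  have hint : Integrable (F k₀) μ :=
    hb.mono' (hmeas k₀ hk₀) (hbound.mono fun a ha => ha k₀ hk₀)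
  exact ((hasDerivAt_integral_of_dominated_loc_of_deriv_le (Metric.ball_mem_nhds k₀ hr2)
    ((hU.eventually_mem hk₀).mono fun k hk => hmeas k hk) hint hmeas' hbound'
    (hb.div_const _) hderiv).2.differentiableAt).differentiableWithinAt

end HolomorphicIntegral

/-! ### The weight exp(2H), H the primitive of the majorant -/

section ExponentialWeight

/-- The primitive of `h` that vanishes at `-∞`. -/
noncomputable def leftPrimitive (h : ℝ → ℝ) (x : ℝ) : ℝ := ∫ y in Iic x, h y

variable {h : ℝ → ℝ}

theorem leftPrimitive_sub (hh : Integrable h) (a b : ℝ) :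
    leftPrimitive h b - leftPrimitive h a = ∫ y in a..b, h y :=
  intervalIntegral.integral_Iic_sub_Iic hh.integrableOn hh.integrableOn

theorem leftPrimitive_nonneg (h0 : ∀ y, 0 ≤ h y) (x : ℝ) : 0 ≤ leftPrimitive h x :=
  integral_nonneg h0

theorem monotone_leftPrimitive (hh : Integrable h) (h0 : ∀ y, 0 ≤ h y) :
    Monotone (leftPrimitive h) := fun a b hab => by
  have := leftPrimitive_sub hh a b
  have h2 : 0 ≤ ∫ y in a..b, h y := intervalIntegral.integral_nonneg hab fun y _ => h0 y
  linarith

theorem continuous_leftPrimitive (hh : Integrable h) : Continuous (leftPrimitive h) := by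
  have h1 : leftPrimitive h = fun x => leftPrimitive h 0 + ∫ y in (0 : ℝ)..x, h y := by
    ext x
    rw [← leftPrimitive_sub hh]
    ring
  rw [h1]
  exact continuous_const.add
    (intervalIntegral.continuous_primitive (fun a b => hh.intervalIntegrable) 0)

theorem ae_hasDerivAt_leftPrimitive (hh : Integrable h) :
    ∀ᵐ x, HasDerivAt (leftPrimitive h) (h x) x := by
  filter_upwards [LocallyIntegrable.ae_hasDerivAt_integral hh.locallyIntegrable] with x hx
  have h1 : leftPrimitive h = fun x => leftPrimitive h 0 + ∫ y in (0 : ℝ)..x, h y := by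
    ext x
    rw [← leftPrimitive_sub hh]
    ring
  rw [h1]
  exact (hx 0).const_add _

theorem integrable_mul_exp_leftPrimitive (hh : Integrable h) (h0 : ∀ y, 0 ≤ h y) :
    Integrable fun y => h y * Real.exp (2 * leftPrimitive h y) := by
  refine hh.mul_bdd (c := Real.exp (2 * ∫ y, h y)) ?_ ?_
  · exact (Real.continuous_exp.comp
      (continuous_const.mul (continuous_leftPrimitive hh))).aestronglyMeasurable
  · refine Eventually.of_forall fun y => ?_
    rw [Real.norm_of_nonneg (Real.exp_pos _).le]
    gcongr
    exact setIntegral_le_integral hh (Eventually.of_forall h0)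

/-- The integrand is a.e. the derivative of exp(2H)/2. The factor 2 in the exponent is what produces
the contraction constant 1/2 later. -/
theorem integral_mul_exp_leftPrimitive_le (hh : Integrable h) (h0 : ∀ y, 0 ≤ h y) (x : ℝ) :
    ∫ y in Iic x, h y * Real.exp (2 * leftPrimitive h y) ≤ Real.exp (2 * leftPrimitive h x) / 2 := by
  have hint := integrable_mul_exp_leftPrimitive hh h0
  refine le_of_tendsto (intervalIntegral_tendsto_integral_Iic x hint.integrableOn tendsto_id) ?_
  filter_upwards [eventually_le_atBot x] with a ha
  have hmono : Monotone fun y => Real.exp (2 * leftPrimitive h y) := fun u v huv => by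
    have := monotone_leftPrimitive hh h0 huv
    simp only
    gcongr
  -- For a monotone function the integral of the a.e. derivative is at most the increment, so
  -- absolute continuity is not needed here.
  have h1 := (hmono.monotoneOn (uIcc a x)).intervalIntegral_deriv_mem_uIcc
  rw [uIcc_of_le (sub_nonneg.2 (hmono ha))] at h1
  have h2 : ∫ y in a..x, deriv (fun y => Real.exp (2 * leftPrimitive h y)) y =
      ∫ y in a..x, 2 * (h y * Real.exp (2 * leftPrimitive h y)) := by
    apply intervalIntegral.integral_congr_ae
    filter_upwards [ae_hasDerivAt_leftPrimitive hh] with y hy _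
    rw [((hy.const_mul 2).exp).deriv]
    ring
  rw [h2, intervalIntegral.integral_const_mul] at h1
  have h3 := h1.2
  have h4 := Real.exp_pos (2 * leftPrimitive h a)
  simp only [id]
  linarith

end ExponentialWeight

/-! ### Volterra equations on a left half-line -/

section Volterra

variable {V : Type*} [NormedAddCommGroup V] [NormedSpace ℂ V]

/-- The terms of the Neumann series of `m(x) = w + ∫_{-∞}^x K(x, y) m(y) dy`. -/
noncomputable def volterraIter (K : ℝ → ℝ → V →L[ℂ] V) (w : V) : ℕ → ℝ → V
  | 0 => fun _ => w
  | n + 1 => fun x => ∫ y in Iic x, K x y (volterraIter K w n y)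

/-- The Neumann series solution of `m(x) = w + ∫_{-∞}^x K(x, y) m(y) dy`. -/
noncomputable def volterraSol (K : ℝ → ℝ → V →L[ℂ] V) (w : V) (x : ℝ) : V :=
  ∑' n, volterraIter K w n x

/-- A kernel on `y ≤ x ≤ X` dominated by an integrable function of `y` alone. -/
structure IsVolterraKernel (K : ℝ → ℝ → V →L[ℂ] V) (h : ℝ → ℝ) (X : ℝ) : Prop where
  integrable : Integrable h
  nonneg : ∀ y, 0 ≤ h y
  bound : ∀ x y, y ≤ x → x ≤ X → ‖K x y‖ ≤ h y
  meas : ∀ x ≤ X, AEStronglyMeasurable (K x) (volume.restrict (Iic x))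

namespace IsVolterraKernel

variable {K : ℝ → ℝ → V →L[ℂ] V} {h : ℝ → ℝ} {X : ℝ}

theorem aestronglyMeasurable_apply (hK : IsVolterraKernel K h X) {u : ℝ → V}
    (hu : ContinuousOn u (Iic X)) {x : ℝ} (hx : x ≤ X) :
    AEStronglyMeasurable (fun y => K x y (u y)) (volume.restrict (Iic x)) :=
  isBoundedBilinearMap_apply.continuous.comp_aestronglyMeasurable
    ((hK.meas x hx).prodMk
      ((hu.mono (Iic_subset_Iic.2 hx)).aestronglyMeasurable measurableSet_Iic))

theorem norm_apply_le (hK : IsVolterraKernel K h X) {x y : ℝ} (hyx : y ≤ x) (hx : x ≤ X) {v : V}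
    {C : ℝ} (hv : ‖v‖ ≤ C) : ‖K x y v‖ ≤ h y * C :=
  (ContinuousLinearMap.le_opNorm _ _).trans
    (mul_le_mul (hK.bound x y hyx hx) hv (norm_nonneg _) (hK.nonneg y))

theorem integrableOn_apply (hK : IsVolterraKernel K h X) {u : ℝ → V}
    (hu : ContinuousOn u (Iic X)) {C : ℝ} (hC : ∀ y ≤ X, ‖u y‖ ≤ C) {x : ℝ} (hx : x ≤ X) :
    IntegrableOn (fun y => K x y (u y)) (Iic x) := by
  refine Integrable.mono' (hK.integrable.integrableOn.mul_const C)
    (hK.aestronglyMeasurable_apply hu hx) ?_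
  filter_upwards [ae_restrict_mem measurableSet_Iic] with y hy
  exact hK.norm_apply_le hy hx (hC y (hy.trans hx))

/-- The contraction estimate: the Volterra operator halves the sup norm weighted by exp(-2H),
whatever the size of ∫ h. -/
theorem norm_integral_apply_le (hK : IsVolterraKernel K h X) {u : ℝ → V} {C : ℝ}
    (hu : ∀ y ≤ X, ‖u y‖ ≤ C * Real.exp (2 * leftPrimitive h y)) {x : ℝ} (hx : x ≤ X)
    (hC : 0 ≤ C) :
    ‖∫ y in Iic x, K x y (u y)‖ ≤ C / 2 * Real.exp (2 * leftPrimitive h x) := by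
  have h1 : ‖∫ y in Iic x, K x y (u y)‖ ≤
      ∫ y in Iic x, C * (h y * Real.exp (2 * leftPrimitive h y)) := by
    refine norm_integral_le_of_norm_le
      ((integrable_mul_exp_leftPrimitive hK.integrable hK.nonneg).integrableOn.const_mul C) ?_
    filter_upwards [ae_restrict_mem measurableSet_Iic] with y hy
    refine (hK.norm_apply_le hy hx (hu y (hy.trans hx))).trans_eq ?_
    ring
  rw [integral_const_mul] at h1
  have h2 := integral_mul_exp_leftPrimitive_le hK.integrable hK.nonneg x
  nlinarith

/-- A bounded fixed point of an operator that halves the weighted norm has norm at most C/2ⁿ for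
every n. -/
theorem eq_zero_of_homogeneous (hK : IsVolterraKernel K h X) {d : ℝ → V} {C : ℝ}
    (hC : ∀ y ≤ X, ‖d y‖ ≤ C) (hd : ∀ x ≤ X, d x = ∫ y in Iic x, K x y (d y)) {x : ℝ}
    (hx : x ≤ X) : d x = 0 := by
  have hC0 : 0 ≤ C := (norm_nonneg _).trans (hC X le_rfl)
  have key : ∀ n : ℕ, ∀ y ≤ X, ‖d y‖ ≤ C / 2 ^ n * Real.exp (2 * leftPrimitive h y) := by
    intro n
    induction n with
    | zero =>
      intro y hy
      have h1 : 1 ≤ Real.exp (2 * leftPrimitive h y) :=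
        Real.one_le_exp (by linarith [leftPrimitive_nonneg hK.nonneg y])
      have h2 := hC y hy
      rw [pow_zero, div_one]
      nlinarith
    | succ n ih =>
      intro y hy
      rw [hd y hy]
      refine (hK.norm_integral_apply_le ih hy (by positivity)).trans_eq ?_
      rw [pow_succ]
      ring
  have hlim : Tendsto (fun n : ℕ => C / 2 ^ n * Real.exp (2 * leftPrimitive h x)) atTop (𝓝 0) := by
    have h1 : Tendsto (fun n : ℕ => C * (1 / 2 : ℝ) ^ n * Real.exp (2 * leftPrimitive h x)) atTop
        (𝓝 (C * 0 * Real.exp (2 * leftPrimitive h x))) :=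
      ((tendsto_pow_atTop_nhds_zero_of_lt_one (by norm_num) (by norm_num)).const_mul C).mul_const _
    simpa [div_eq_mul_inv] using h1
  exact norm_le_zero_iff.1 (ge_of_tendsto' hlim fun n => key n x hx)

variable {T : Type*} [TopologicalSpace T] [FirstCountableTopology T] {S : Set T}
  {Kp : T → ℝ → ℝ → V →L[ℂ] V}

/-- Writing the moving endpoint as an indicator allows dominated convergence; the integrand is
continuous in the parameters except at y = x₀, a null set. -/
theorem continuousOn_integral_apply (hK : ∀ P ∈ S, IsVolterraKernel (Kp P) h X)
    (hcont : ∀ y, ContinuousOn (fun p : T × ℝ => Kp p.1 p.2 y) (S ×ˢ Iic X))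
    {u : T → ℝ → V} {C : ℝ}
    (hu : ContinuousOn (fun p : T × ℝ => u p.1 p.2) (S ×ˢ Iic X))
    (hC : ∀ P ∈ S, ∀ y ≤ X, ‖u P y‖ ≤ C) :
    ContinuousOn (fun p : T × ℝ => ∫ y in Iic p.2, Kp p.1 p.2 y (u p.1 y)) (S ×ˢ Iic X) := by
  rintro ⟨P₀, x₀⟩ ⟨hP₀, hx₀⟩
  have hslice : ∀ P ∈ S, ContinuousOn (u P) (Iic X) := fun P hP =>
    hu.comp (by fun_prop : ContinuousOn (fun y : ℝ => (P, y)) (Iic X)) fun y hy => ⟨hP, hy⟩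
  simp_rw [← integral_indicator measurableSet_Iic]
  refine continuousWithinAt_of_dominated (bound := fun y => h y * C) ?_ ?_
    ((hK P₀ hP₀).integrable.mul_const C) ?_
  · filter_upwards [self_mem_nhdsWithin] with p hp
    exact (aestronglyMeasurable_indicator_iff measurableSet_Iic).2
      ((hK p.1 hp.1).aestronglyMeasurable_apply (hslice p.1 hp.1) hp.2)
  · filter_upwards [self_mem_nhdsWithin] with p hp
    refine Eventually.of_forall fun y => ?_
    by_cases hy : y ∈ Iic p.2
    · rw [indicator_of_mem hy]
      exact (hK p.1 hp.1).norm_apply_le hy hp.2 (hC p.1 hp.1 y (le_trans hy hp.2))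
    · rw [indicator_of_notMem hy, norm_zero]
      exact mul_nonneg ((hK p.1 hp.1).nonneg y)
        ((norm_nonneg _).trans (hC P₀ hP₀ X le_rfl))
  · have hne : ∀ᵐ y : ℝ, y ≠ x₀ := by simp [ae_iff, measure_singleton]
    filter_upwards [hne] with y hy
    rcases lt_or_gt_of_ne hy with hlt | hgt
    · have hev : ∀ᶠ p : T × ℝ in 𝓝[S ×ˢ Iic X] (P₀, x₀), y < p.2 :=
        nhdsWithin_le_nhds ((continuous_snd.tendsto (P₀, x₀)).eventually (lt_mem_nhds hlt))
      have hyX : y ≤ X := hlt.le.trans hx₀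
      have huy : ContinuousOn (fun p : T × ℝ => u p.1 y) (S ×ˢ Iic X) :=
        hu.comp (by fun_prop : ContinuousOn (fun p : T × ℝ => (p.1, y)) (S ×ˢ Iic X))
          fun p hp => ⟨hp.1, hyX⟩
      have hmain : ContinuousWithinAt (fun p : T × ℝ => Kp p.1 p.2 y (u p.1 y)) (S ×ˢ Iic X)
          (P₀, x₀) := (hcont y).clm_apply huy (P₀, x₀) ⟨hP₀, hx₀⟩
      refine hmain.congr_of_eventuallyEq ?_ ?_
      · filter_upwards [hev] with p hp
        exact indicator_of_mem (mem_Iic.2 hp.le) _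
      · exact indicator_of_mem (mem_Iic.2 hlt.le) _
    · have hev : ∀ᶠ p : T × ℝ in 𝓝[S ×ˢ Iic X] (P₀, x₀), p.2 < y :=
        nhdsWithin_le_nhds ((continuous_snd.tendsto (P₀, x₀)).eventually (gt_mem_nhds hgt))
      refine (continuousWithinAt_const (b := (0 : V))).congr_of_eventuallyEq ?_ ?_
      · filter_upwards [hev] with p hp
        exact indicator_of_notMem (notMem_Iic.2 hp) _
      · exact indicator_of_notMem (notMem_Iic.2 hgt) _

theorem norm_volterraIter_le (hK : IsVolterraKernel K h X) {w : V} {W : ℝ} (hw : ‖w‖ ≤ W) (n : ℕ) :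
    ∀ x ≤ X, ‖volterraIter K w n x‖ ≤ W / 2 ^ n * Real.exp (2 * leftPrimitive h x) := by
  have hW : 0 ≤ W := (norm_nonneg _).trans hw
  induction n with
  | zero =>
    intro x _
    have h1 : 1 ≤ Real.exp (2 * leftPrimitive h x) :=
      Real.one_le_exp (by linarith [leftPrimitive_nonneg hK.nonneg x])
    rw [pow_zero, div_one]
    simp only [volterraIter]
    nlinarith
  | succ n ih =>
    intro x hx
    refine (hK.norm_integral_apply_le ih hx (by positivity)).trans_eq ?_
    rw [pow_succ]
    ring

theorem norm_volterraIter_le' (hK : IsVolterraKernel K h X) {w : V} {W : ℝ} (hw : ‖w‖ ≤ W) (n : ℕ)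
    {x : ℝ} (hx : x ≤ X) :
    ‖volterraIter K w n x‖ ≤ W * Real.exp (2 * leftPrimitive h X) * (1 / 2) ^ n := by
  have hW : 0 ≤ W := (norm_nonneg _).trans hw
  refine (hK.norm_volterraIter_le hw n x hx).trans ?_
  have h1 : Real.exp (2 * leftPrimitive h x) ≤ Real.exp (2 * leftPrimitive h X) :=
    Real.exp_le_exp.2 (by linarith [monotone_leftPrimitive hK.integrable hK.nonneg hx])
  calc W / 2 ^ n * Real.exp (2 * leftPrimitive h x)
      ≤ W / 2 ^ n * Real.exp (2 * leftPrimitive h X) := by gcongr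
    _ = _ := by rw [one_div, inv_pow]; ring

theorem summable_volterra_bound (W : ℝ) :
    Summable fun n : ℕ => W * Real.exp (2 * leftPrimitive h X) * (1 / 2) ^ n :=
  summable_geometric_two.mul_left _

theorem continuousOn_volterraIter (hK : ∀ P ∈ S, IsVolterraKernel (Kp P) h X)
    (hcont : ∀ y, ContinuousOn (fun p : T × ℝ => Kp p.1 p.2 y) (S ×ˢ Iic X))
    {w : T → V} (hwc : ContinuousOn w S) {W : ℝ} (hw : ∀ P ∈ S, ‖w P‖ ≤ W) (n : ℕ) :
    ContinuousOn (fun p : T × ℝ => volterraIter (Kp p.1) (w p.1) n p.2) (S ×ˢ Iic X) := by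
  induction n with
  | zero => exact hwc.comp continuousOn_fst fun p hp => hp.1
  | succ n ih =>
    exact continuousOn_integral_apply hK hcont ih fun P hP y hy =>
      (hK P hP).norm_volterraIter_le' (hw P hP) n hy

theorem norm_volterraSol_le (hK : IsVolterraKernel K h X) (w : V) {x : ℝ} (hx : x ≤ X) :
    ‖volterraSol K w x‖ ≤ ∑' n : ℕ, ‖w‖ * Real.exp (2 * leftPrimitive h X) * (1 / 2) ^ n :=
  tsum_of_norm_bounded (summable_volterra_bound ‖w‖).hasSum
    fun n => hK.norm_volterraIter_le' le_rfl n hx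

variable [CompleteSpace V]

theorem continuousOn_volterraSol (hK : ∀ P ∈ S, IsVolterraKernel (Kp P) h X)
    (hcont : ∀ y, ContinuousOn (fun p : T × ℝ => Kp p.1 p.2 y) (S ×ˢ Iic X))
    {w : T → V} (hwc : ContinuousOn w S) {W : ℝ} (hw : ∀ P ∈ S, ‖w P‖ ≤ W) :
    ContinuousOn (fun p : T × ℝ => volterraSol (Kp p.1) (w p.1) p.2) (S ×ˢ Iic X) :=
  continuousOn_tsum (continuousOn_volterraIter hK hcont hwc hw)
    (summable_volterra_bound W) fun n p hp => (hK p.1 hp.1).norm_volterraIter_le' (hw p.1 hp.1) n hp.2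

/-- Weierstrass: the Neumann series converges uniformly, and each term is holomorphic by induction,
as a dominated integral of a holomorphic integrand. -/
theorem differentiableOn_volterraSol {U : Set ℂ} (hU : IsOpen U) {Kc : ℂ → ℝ → ℝ → V →L[ℂ] V}
    (hK : ∀ k ∈ U, IsVolterraKernel (Kc k) h X)
    (hcont : ∀ y, ContinuousOn (fun p : ℂ × ℝ => Kc p.1 p.2 y) (U ×ˢ Iic X))
    (hdiff : ∀ x y, DifferentiableOn ℂ (fun k => Kc k x y) U)
    {w : ℂ → V} (hwd : DifferentiableOn ℂ w U) {W : ℝ} (hw : ∀ k ∈ U, ‖w k‖ ≤ W)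
    {x : ℝ} (hx : x ≤ X) : DifferentiableOn ℂ (fun k => volterraSol (Kc k) (w k) x) U := by
  refine Complex.differentiableOn_tsum_of_summable_norm (summable_volterra_bound W) (fun n => ?_) hU
    fun n k hk => (hK k hk).norm_volterraIter_le' (hw k hk) n hx
  induction n generalizing x with
  | zero => exact hwd
  | succ n ih =>
    -- Integrability of `h` is only available through a kernel, hence through a point of `U`.
    rcases U.eq_empty_or_nonempty with rfl | ⟨k₀, hk₀⟩
    · exact differentiableOn_empty
    refine differentiableOn_integral_of_dominated hU
      (((hK k₀ hk₀).integrable.integrableOn (s := Iic x)).mul_const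
        (W * Real.exp (2 * leftPrimitive h X) * (1 / 2) ^ n)) ?_ ?_ ?_
    · intro k hk
      refine (hK k hk).aestronglyMeasurable_apply ?_ hx
      exact (continuousOn_volterraIter hK hcont hwd.continuousOn hw n).comp
        (by fun_prop : ContinuousOn (fun y : ℝ => (k, y)) (Iic X)) fun y hy => ⟨hk, hy⟩
    · filter_upwards [ae_restrict_mem measurableSet_Iic] with y hy k hk
      exact (hK k hk).norm_apply_le hy hx
        ((hK k hk).norm_volterraIter_le' (hw k hk) n (le_trans hy hx))
    · filter_upwards [ae_restrict_mem measurableSet_Iic] with y hy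
      exact (hdiff x y).clm_apply (ih (le_trans hy hx))

/-- Joint continuity, specialised to a one-point parameter space. -/
theorem continuousOn_volterraSol_right (hK : IsVolterraKernel K h X)
    (hcont : ∀ y, Continuous fun x => K x y) (w : V) : ContinuousOn (volterraSol K w) (Iic X) :=
  (continuousOn_volterraSol (S := (univ : Set Unit)) (Kp := fun _ => K) (fun _ _ => hK)
    (fun y => ((hcont y).comp continuous_snd).continuousOn) (w := fun _ => w) continuousOn_const
    fun _ _ => le_rfl).comp (by fun_prop : ContinuousOn (fun y : ℝ => ((), y)) (Iic X))
    fun _ hy => ⟨trivial, hy⟩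

theorem volterraSol_eq (hK : IsVolterraKernel K h X)
    (hcont : ∀ y, Continuous fun x => K x y) (w : V) {x : ℝ} (hx : x ≤ X) :
    volterraSol K w x = w + ∫ y in Iic x, K x y (volterraSol K w y) := by
  have hsum : ∀ y ≤ X, Summable fun n => volterraIter K w n y := fun y hy =>
    Summable.of_norm_bounded (summable_volterra_bound ‖w‖)
      fun n => hK.norm_volterraIter_le' le_rfl n hy
  have hcontIter : ∀ n, ContinuousOn (volterraIter K w n) (Iic X) := fun n =>
    (continuousOn_volterraIter (S := (univ : Set Unit)) (Kp := fun _ => K) (fun _ _ => hK)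
      (fun y => ((hcont y).comp continuous_snd).continuousOn) (w := fun _ => w) continuousOn_const
      (fun _ _ => le_rfl) n).comp (by fun_prop : ContinuousOn (fun y : ℝ => ((), y)) (Iic X))
      fun _ hy => ⟨trivial, hy⟩
  have hint : HasSum (fun n => ∫ y in Iic x, K x y (volterraIter K w n y))
      (∫ y in Iic x, K x y (volterraSol K w y)) := by
    refine hasSum_integral_of_dominated_convergence
      (fun n y => h y * (‖w‖ * Real.exp (2 * leftPrimitive h X) * (1 / 2) ^ n))
      (fun n => hK.aestronglyMeasurable_apply (hcontIter n) hx) (fun n => ?_)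
      (Eventually.of_forall fun y => (summable_volterra_bound ‖w‖).mul_left _) ?_ ?_
    · filter_upwards [ae_restrict_mem measurableSet_Iic] with y hy
      exact hK.norm_apply_le hy hx (hK.norm_volterraIter_le' le_rfl n (le_trans hy hx))
    · simp_rw [tsum_mul_left]
      exact hK.integrable.integrableOn.mul_const _
    · filter_upwards [ae_restrict_mem measurableSet_Iic] with y hy
      exact (K x y).hasSum (hsum y (le_trans hy hx)).hasSum
  rw [volterraSol, (hsum x hx).tsum_eq_zero_add, ← hint.tsum_eq]
  rfl

end IsVolterraKernel

end Volterra

/-! ### Product rule for Carathéodory solutions -/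

section ProductRule

/-- The increments of `F` are dominated by those of the primitive of `ω`, which is absolutely
continuous. -/
theorem absolutelyContinuousOnInterval_of_norm_sub_le {V : Type*} [NormedAddCommGroup V]
    {F : ℝ → V} {ω : ℝ → ℝ} {a b : ℝ} (hω : IntervalIntegrable ω volume a b)
    (h : ∀ x ∈ uIcc a b, ∀ y ∈ uIcc a b, x ≤ y → ‖F y - F x‖ ≤ ∫ z in x..y, ω z) :
    AbsolutelyContinuousOnInterval F a b := by
  have hW := hω.absolutelyContinuousOnInterval_intervalIntegral (c := a) left_mem_uIcc
  have hle : ∀ x ∈ uIcc a b, ∀ y ∈ uIcc a b,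
      dist (F x) (F y) ≤ dist (∫ v in a..x, ω v) (∫ v in a..y, ω v) := by
    have hsub : ∀ x ∈ uIcc a b, ∀ y ∈ uIcc a b,
        (∫ v in a..y, ω v) - ∫ v in a..x, ω v = ∫ z in x..y, ω z := fun x hx y hy =>
      intervalIntegral.integral_interval_sub_left
        (hω.mono_set (uIcc_subset_uIcc left_mem_uIcc hy))
        (hω.mono_set (uIcc_subset_uIcc left_mem_uIcc hx))
    intro x hx y hy
    rcases le_total x y with hxy | hxy
    · rw [dist_comm, dist_comm (∫ v in a..x, ω v), dist_eq_norm, dist_eq_norm, hsub x hx y hy]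
      exact (h x hx y hy hxy).trans (le_abs_self _)
    · rw [dist_eq_norm, dist_eq_norm, hsub y hy x hx]
      exact (h y hy x hx hxy).trans (le_abs_self _)
  rw [absolutelyContinuousOnInterval_iff] at hW ⊢
  intro ε hε
  obtain ⟨δ, hδ, hδ'⟩ := hW ε hε
  refine ⟨δ, hδ, fun I hI hlt => (Finset.sum_le_sum fun i hi => ?_).trans_lt (hδ' I hI hlt)⟩
  have hmem := hI.1 i hi
  exact hle _ hmem.1 _ hmem.2

variable {V : Type*} [NormedAddCommGroup V] [NormedSpace ℂ V]

theorem _root_.IntervalIntegrable.clm_apply_of_continuous {Φ : ℝ → V →L[ℂ] V} {f : ℝ → V}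
    {a b : ℝ} (hf : IntervalIntegrable f volume a b) (hΦ : Continuous Φ) :
    IntervalIntegrable (fun x => Φ x (f x)) volume a b := by
  obtain ⟨C, hC⟩ := isCompact_uIcc.exists_bound_of_continuousOn (hΦ.continuousOn (s := uIcc a b))
  rw [intervalIntegrable_iff] at hf ⊢
  refine Integrable.mono' (hf.norm.const_mul C)
    (isBoundedBilinearMap_apply.continuous.comp_aestronglyMeasurable
      (hΦ.aestronglyMeasurable.prodMk hf.aestronglyMeasurable)) ?_
  filter_upwards [ae_restrict_mem measurableSet_uIoc] with x hx
  exact (ContinuousLinearMap.le_opNorm _ _).trans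
    (mul_le_mul_of_nonneg_right (hC x (uIoc_subset_uIcc hx)) (norm_nonneg _))

/-- The product rule for a `C¹` operator function and a primitive of a locally integrable
function, in integrated form. -/
theorem integral_product_rule [CompleteSpace V] {Φ Φ' : ℝ → V →L[ℂ] V} {v f : ℝ → V}
    (hΦ : ∀ x, HasDerivAt Φ (Φ' x) x) (hΦ' : Continuous Φ') (hvc : Continuous v)
    (hf : ∀ a b, IntervalIntegrable f volume a b) (hv : ∀ a b, v b - v a = ∫ x in a..b, f x)
    (a b : ℝ) :
    IntervalIntegrable (fun x => Φ' x (v x) + Φ x (f x)) volume a b ∧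
      Φ b (v b) - Φ a (v a) = ∫ x in a..b, (Φ' x (v x) + Φ x (f x)) := by
  have hΦc : Continuous Φ := continuous_iff_continuousAt.2 fun x => (hΦ x).continuousAt
  set g : ℝ → V := fun x => Φ' x (v x) + Φ x (f x) with hg_def
  have hg : ∀ a b, IntervalIntegrable g volume a b := fun a b =>
    ((hΦ'.clm_apply hvc).intervalIntegrable a b).add ((hf a b).clm_apply_of_continuous hΦc)
  refine ⟨hg a b, ?_⟩
  obtain ⟨C₁, hC₁⟩ := isCompact_uIcc.exists_bound_of_continuousOn (hΦc.continuousOn (s := uIcc a b))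
  obtain ⟨C₂, hC₂⟩ := isCompact_uIcc.exists_bound_of_continuousOn (hΦ'.continuousOn (s := uIcc a b))
  obtain ⟨C₃, hC₃⟩ := isCompact_uIcc.exists_bound_of_continuousOn (hvc.continuousOn (s := uIcc a b))
  -- The defect in the claimed identity: absolutely continuous with a.e. derivative zero, hence
  -- constant.
  let F : ℝ → V := fun x => Φ x (v x) - ∫ y in a..x, g y
  have hω : ∀ x y, IntervalIntegrable (fun z => C₁ * ‖f z‖ + C₂ * C₃ + ‖g z‖) volume x y :=
    fun x y => (((hf x y).norm.const_mul C₁).add intervalIntegrable_const).add (hg x y).norm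
  have hFac : AbsolutelyContinuousOnInterval F a b := by
    refine absolutelyContinuousOnInterval_of_norm_sub_le (hω a b) fun x hx y hy hxy => ?_
    have hsplit : F y - F x = Φ y (∫ z in x..y, f z) + (Φ y - Φ x) (v x) - ∫ z in x..y, g z := by
      rw [← hv x y, ← intervalIntegral.integral_interval_sub_left (hg a y) (hg a x)]
      simp only [F, map_sub, sub_apply]
      abel
    have h1 : ‖∫ z in x..y, f z‖ ≤ ∫ z in x..y, ‖f z‖ :=
      intervalIntegral.norm_integral_le_integral_norm hxy
    have h2 : ‖∫ z in x..y, g z‖ ≤ ∫ z in x..y, ‖g z‖ :=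
      intervalIntegral.norm_integral_le_integral_norm hxy
    have h3 : ‖Φ y - Φ x‖ ≤ C₂ * (y - x) := by
      have := (convex_uIcc a b).norm_image_sub_le_of_norm_hasDerivWithin_le
        (fun z _ => (hΦ z).hasDerivWithinAt) hC₂ hx hy
      rwa [Real.norm_of_nonneg (sub_nonneg.2 hxy)] at this
    have h4 : ‖Φ y (∫ z in x..y, f z)‖ ≤ C₁ * ∫ z in x..y, ‖f z‖ :=
      (ContinuousLinearMap.le_opNorm _ _).trans
        (mul_le_mul (hC₁ y hy) h1 (norm_nonneg _) ((norm_nonneg _).trans (hC₁ y hy)))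
    have h5 : ‖(Φ y - Φ x) (v x)‖ ≤ C₂ * (y - x) * C₃ :=
      (ContinuousLinearMap.le_opNorm _ _).trans
        (mul_le_mul h3 (hC₃ x hx) (norm_nonneg _) ((norm_nonneg _).trans h3))
    rw [hsplit, intervalIntegral.integral_add
      (((hf x y).norm.const_mul C₁).add intervalIntegrable_const) (hg x y).norm,
      intervalIntegral.integral_add ((hf x y).norm.const_mul C₁) intervalIntegrable_const,
      intervalIntegral.integral_const_mul, intervalIntegral.integral_const, smul_eq_mul]
    have h6 := norm_sub_le (Φ y (∫ z in x..y, f z) + (Φ y - Φ x) (v x)) (∫ z in x..y, g z)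
    have h7 := norm_add_le (Φ y (∫ z in x..y, f z)) ((Φ y - Φ x) (v x))
    nlinarith
  have hderiv : ∀ᵐ x, x ∈ uIcc a b → HasDerivAt F 0 x := by
    filter_upwards [(hf a b).ae_hasDerivAt_integral, (hg a b).ae_hasDerivAt_integral]
      with x hx1 hx2 hx
    have hvx : HasDerivAt v (f x) x := by
      have h1 : v = fun x => v a + ∫ z in a..x, f z := by
        ext x
        rw [← hv a x]
        abel
      rw [h1]
      exact (hx1 hx a left_mem_uIcc).const_add _
    -- The variable is real, so the bilinear product rule is applied to real-linear operators.
    have hΦx : HasDerivAt (fun x => (Φ x).restrictScalars ℝ) ((Φ' x).restrictScalars ℝ) x :=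
      (ContinuousLinearMap.restrictScalarsL ℂ V V ℝ ℝ).hasFDerivAt.comp_hasDerivAt x (hΦ x)
    have h2 := (hΦx.clm_apply hvx).sub (hx2 hx a left_mem_uIcc)
    convert! h2 using 1
    simp [g]
  obtain ⟨C, hC⟩ := hFac.const_of_ae_hasDerivAt_zero hderiv
  have h1 : F b = F a := (hC b right_mem_uIcc).trans (hC a left_mem_uIcc).symm
  simp only [F, intervalIntegral.integral_same, sub_zero] at h1
  rw [← h1]
  abel

end ProductRule

/-! ### Linear equations and exponential factors -/

section LinearODE

variable {V : Type*} [NormedAddCommGroup V] [NormedSpace ℂ V]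

/-- `v` is a Carathéodory solution of `v' = (A + B(x)) v` on `ℝ`. -/
def IsODESolution (A : V →L[ℂ] V) (B : ℝ → V →L[ℂ] V) (v : ℝ → V) : Prop :=
  Continuous v ∧ ∀ a b : ℝ, IntervalIntegrable (fun x => (A + B x) (v x)) volume a b ∧
    v b - v a = ∫ x in a..b, (A + B x) (v x)

variable {A : V →L[ℂ] V} {B : ℝ → V →L[ℂ] V} {v : ℝ → V}

theorem IsODESolution.sub {u : ℝ → V} (hu : IsODESolution A B u) (hv : IsODESolution A B v) :
    IsODESolution A B fun x => u x - v x := by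
  refine ⟨hu.1.sub hv.1, fun a b => ?_⟩
  simp_rw [map_sub]
  refine ⟨((hu.2 a b).1).sub (hv.2 a b).1, ?_⟩
  rw [intervalIntegral.integral_sub (hu.2 a b).1 (hv.2 a b).1, ← (hu.2 a b).2, ← (hv.2 a b).2]
  abel

theorem hasDerivAt_cexp_mul_ofReal (c : ℂ) (x : ℝ) :
    HasDerivAt (fun x : ℝ => Complex.exp (c * x)) (c * Complex.exp (c * x)) x := by
  have h1 : HasDerivAt (fun z : ℂ => Complex.exp (c * z)) (Complex.exp (c * x) * (c * 1)) x :=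
    ((hasDerivAt_id (x : ℂ)).const_mul c).cexp
  convert! h1.comp_ofReal using 1
  ring

/-- An exponential factor shifts the constant part of the coefficient by a scalar; this removes the
exponential from the Jost solutions. -/
theorem IsODESolution.cexp_smul [CompleteSpace V] (hv : IsODESolution A B v) (c : ℂ) :
    IsODESolution (A + c • 1) B fun x => Complex.exp (c * x) • v x := by
  have h := integral_product_rule
    (Φ := fun x => Complex.exp (c * x) • (1 : V →L[ℂ] V))
    (Φ' := fun x => (c * Complex.exp (c * x)) • (1 : V →L[ℂ] V))
    (fun x => (hasDerivAt_cexp_mul_ofReal c x).smul_const (1 : V →L[ℂ] V)) (by fun_prop) hv.1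
    (fun a b => (hv.2 a b).1) (fun a b => (hv.2 a b).2)
  have heq : ∀ x : ℝ, (A + c • 1 + B x) (Complex.exp (c * x) • v x) =
      ((c * Complex.exp (c * x)) • (1 : V →L[ℂ] V)) (v x) +
        (Complex.exp (c * x) • (1 : V →L[ℂ] V)) ((A + B x) (v x)) := by
    intro x
    simp only [add_apply, map_smul, smul_apply,
      one_apply_eq_self]
    module
  refine ⟨(by fun_prop : Continuous fun x : ℝ => Complex.exp (c * x)).smul hv.1, fun a b => ?_⟩
  simp_rw [heq]
  exact h a b

end LinearODE

/-! ### The propagator e^{sE} for E² = μE -/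

section Propagator

/-- The function `(e^{μs} - 1)/μ`, extended by `s` to `μ = 0`. -/
noncomputable def relExp (μ : ℂ) (s : ℝ) : ℂ := s * dslope Complex.exp 0 (μ * s)

theorem mul_relExp (μ : ℂ) (s : ℝ) : μ * relExp μ s = Complex.exp (μ * s) - 1 := by
  have h := sub_smul_dslope Complex.exp 0 (μ * s)
  rw [sub_zero, Complex.exp_zero, smul_eq_mul] at h
  rw [relExp, ← h]
  ring

theorem relExp_of_ne {μ : ℂ} (hμ : μ ≠ 0) (s : ℝ) :
    relExp μ s = (Complex.exp (μ * s) - 1) / μ := by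
  rw [← mul_relExp, mul_div_cancel_left₀ _ hμ]

theorem relExp_zero (s : ℝ) : relExp 0 s = s := by
  simp [relExp, dslope_same]

theorem differentiable_dslope_exp : Differentiable ℂ (dslope Complex.exp 0) :=
  differentiableOn_univ.1
    ((Complex.differentiableOn_dslope univ_mem).2 Complex.differentiable_exp.differentiableOn)

theorem continuous_relExp : Continuous fun p : ℂ × ℝ => relExp p.1 p.2 :=
  (by fun_prop : Continuous fun p : ℂ × ℝ => (p.2 : ℂ)).mul
    (differentiable_dslope_exp.continuous.comp (by fun_prop))

theorem differentiable_relExp (s : ℝ) : Differentiable ℂ fun μ => relExp μ s :=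
  (differentiable_dslope_exp.comp (by fun_prop : Differentiable ℂ fun μ : ℂ => μ * s)).const_mul _

theorem hasDerivAt_relExp (μ : ℂ) (s : ℝ) : HasDerivAt (relExp μ) (Complex.exp (μ * s)) s := by
  rcases eq_or_ne μ 0 with rfl | hμ
  · have h1 : relExp 0 = fun s : ℝ => (s : ℂ) := funext relExp_zero
    rw [h1, zero_mul, Complex.exp_zero]
    exact Complex.ofRealCLM.hasDerivAt
  · have h1 : relExp μ = fun s : ℝ => (Complex.exp (μ * s) - 1) / μ := funext (relExp_of_ne hμ)
    rw [h1]
    have h2 := ((hasDerivAt_cexp_mul_ofReal μ s).sub_const 1).div_const μ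
    rwa [mul_div_cancel_left₀ _ hμ] at h2

theorem norm_exp_le_one_of_re_nonpos {z : ℂ} (hz : z.re ≤ 0) : ‖Complex.exp z‖ ≤ 1 := by
  rw [Complex.norm_exp]
  exact Real.exp_le_one_iff.2 hz

/-- Mean value inequality on the convex half-plane Re z ≤ 0, where |e^z| ≤ 1. It yields the bound on
`relExp` that survives μ = 0. -/
theorem norm_dslope_exp_le_one {z : ℂ} (hz : z.re ≤ 0) : ‖dslope Complex.exp 0 z‖ ≤ 1 := by
  rcases eq_or_ne z 0 with rfl | hne
  · simp [dslope_same]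
  · have hconv : Convex ℝ {z : ℂ | z.re ≤ 0} := convex_halfSpace_re_le 0
    have h1 := hconv.norm_image_sub_le_of_norm_hasDerivWithin_le (C := 1)
      (fun w _ => (Complex.hasDerivAt_exp w).hasDerivWithinAt)
      (fun w hw => norm_exp_le_one_of_re_nonpos hw) (by simp : (0 : ℂ) ∈ {z : ℂ | z.re ≤ 0}) hz
    rw [← sub_smul_dslope, sub_zero, norm_smul, one_mul] at h1
    exact le_of_mul_le_mul_left (by rwa [mul_one]) (norm_pos_iff.2 hne)

theorem norm_relExp_le {μ : ℂ} (hμ : μ.re ≤ 0) {s : ℝ} (hs : 0 ≤ s) : ‖relExp μ s‖ ≤ s := by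
  have h1 : (μ * s).re ≤ 0 := by
    rw [Complex.re_mul_ofReal]
    exact mul_nonpos_of_nonpos_of_nonneg hμ hs
  rw [relExp, norm_mul, Complex.norm_real, Real.norm_of_nonneg hs]
  exact mul_le_of_le_one_right hs (norm_dslope_exp_le_one h1)

theorem norm_relExp_le_two_div {μ : ℂ} (hμ : μ.re ≤ 0) (hne : μ ≠ 0) {s : ℝ} (hs : 0 ≤ s) :
    ‖relExp μ s‖ ≤ 2 / ‖μ‖ := by
  have h1 : (μ * s).re ≤ 0 := by
    rw [Complex.re_mul_ofReal]
    exact mul_nonpos_of_nonpos_of_nonneg hμ hs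
  rw [relExp_of_ne hne, norm_div]
  gcongr
  refine (norm_sub_le _ _).trans ?_
  rw [norm_one]
  linarith [norm_exp_le_one_of_re_nonpos h1]

/-- The scalar form of the group law e^{(s+t)E} = e^{sE} e^{tE} when E² = μE. -/
theorem relExp_add (μ : ℂ) (s t : ℝ) :
    relExp μ (s + t) = relExp μ s + relExp μ t + μ * (relExp μ s * relExp μ t) := by
  rcases eq_or_ne μ 0 with rfl | hμ
  · simp [relExp_zero]
  · apply mul_left_cancel₀ hμ
    have h1 : μ * (relExp μ s + relExp μ t + μ * (relExp μ s * relExp μ t)) =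
      μ * relExp μ s + μ * relExp μ t + (μ * relExp μ s) * (μ * relExp μ t) := by ring
    rw [h1, mul_relExp, mul_relExp, mul_relExp, Complex.ofReal_add, mul_add, Complex.exp_add]
    ring

variable {V : Type*} [NormedAddCommGroup V] [NormedSpace ℂ V]

/-- The exponential `e^{sE}` of an operator with `E² = μE`. -/
noncomputable def propagator (μ : ℂ) (E : V →L[ℂ] V) (s : ℝ) : V →L[ℂ] V := 1 + relExp μ s • E

variable {μ : ℂ} {E : V →L[ℂ] V}

theorem propagator_zero : propagator μ E 0 = 1 := by
  simp [propagator, relExp]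

theorem propagator_mul (hE : E * E = μ • E) (s t : ℝ) :
    propagator μ E s * propagator μ E t = propagator μ E (s + t) := by
  simp only [propagator, relExp_add, mul_add, add_mul, one_mul, mul_one, smul_mul_smul_comm, hE]
  module

theorem propagator_mul_self (hE : E * E = μ • E) (s : ℝ) :
    propagator μ E s * E = Complex.exp (μ * s) • E := by
  have h1 : Complex.exp (μ * s) = 1 + μ * relExp μ s := by rw [mul_relExp]; ring
  rw [propagator, h1, add_mul, one_mul, smul_mul_assoc, hE]
  module

theorem self_mul_propagator (hE : E * E = μ • E) (s : ℝ) :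
    E * propagator μ E s = Complex.exp (μ * s) • E := by
  have h1 : Complex.exp (μ * s) = 1 + μ * relExp μ s := by rw [mul_relExp]; ring
  rw [propagator, h1, mul_add, mul_one, mul_smul_comm, hE]
  module

theorem propagator_apply_of_apply_eq_zero {w : V} (hw : E w = 0) (s : ℝ) :
    propagator μ E s w = w := by
  simp [propagator, hw]

theorem hasDerivAt_propagator (μ : ℂ) (E : V →L[ℂ] V) (s : ℝ) :
    HasDerivAt (propagator μ E) (Complex.exp (μ * s) • E) s :=
  ((hasDerivAt_relExp μ s).smul_const E).const_add 1

theorem continuous_propagator (μ : ℂ) (E : V →L[ℂ] V) : Continuous (propagator μ E) :=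
  continuous_iff_continuousAt.2 fun s => (hasDerivAt_propagator μ E s).continuousAt

theorem norm_propagator_le {R : ℝ} {s : ℝ} (h : ‖relExp μ s‖ ≤ R) :
    ‖propagator μ E s‖ ≤ 1 + R * ‖E‖ := by
  refine (norm_add_le _ _).trans (add_le_add ContinuousLinearMap.norm_id_le ?_)
  rw [norm_smul]
  gcongr

/-- The Volterra kernel of `m' = (E + B(x)) m` with prescribed limit at `-∞`. -/
noncomputable def jostKernel (μ : ℂ) (E : V →L[ℂ] V) (B : ℝ → V →L[ℂ] V) (x y : ℝ) : V →L[ℂ] V :=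
  propagator μ E (x - y) * B y

theorem continuous_jostKernel_left (μ : ℂ) (E : V →L[ℂ] V) (B : ℝ → V →L[ℂ] V) (y : ℝ) :
    Continuous fun x => jostKernel μ E B x y :=
  ((continuous_propagator μ E).comp (by fun_prop)).mul continuous_const

variable [CompleteSpace V] {B : ℝ → V →L[ℂ] V} {m : ℝ → V}

/-- Variation of constants: differentiate y ↦ e^{(x-y)E} m(y). The two terms containing E alone
cancel because e^{sE} E = e^{μs} E. -/
theorem IsODESolution.duhamel (hE : E * E = μ • E) (hm : IsODESolution E B m) (a x : ℝ) :
    IntervalIntegrable (fun y => jostKernel μ E B x y (m y)) volume a x ∧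
      m x = propagator μ E (x - a) (m a) + ∫ y in a..x, jostKernel μ E B x y (m y) := by
  have h := integral_product_rule
    (Φ := fun y => propagator μ E (x - y)) (Φ' := fun y => -(Complex.exp (μ * (x - y : ℝ)) • E))
    (fun y => by
      have h0 := (hasDerivAt_propagator μ E (x - y)).scomp y ((hasDerivAt_id y).const_sub x)
      rw [neg_one_smul] at h0
      exact h0)
    (by fun_prop) hm.1 (fun a b => (hm.2 a b).1)
    (fun a b => (hm.2 a b).2) a x
  have heq : ∀ y, (-(Complex.exp (μ * (x - y : ℝ)) • E)) (m y) +
      propagator μ E (x - y) ((E + B y) (m y)) = jostKernel μ E B x y (m y) := by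
    intro y
    rw [← propagator_mul_self hE, jostKernel]
    simp only [neg_apply, mul_apply_eq_comp,
      add_apply, map_add]
    abel
  simp_rw [heq, sub_self, propagator_zero] at h
  refine ⟨h.1, ?_⟩
  rw [← h.2]
  simp

/-- The converse of variation of constants: apply the product rule to e^{xE} acting on e^{-xE} m(x).
-/
theorem isODESolution_of_propagator (hE : E * E = μ • E) (hm : Continuous m)
    (hint : ∀ a b, IntervalIntegrable (fun y => propagator μ E (-y) (B y (m y))) volume a b)
    (heq : ∀ a b, propagator μ E (-b) (m b) - propagator μ E (-a) (m a) =
      ∫ y in a..b, propagator μ E (-y) (B y (m y))) : IsODESolution E B m := by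
  have hcancel : ∀ (x : ℝ) (u : V), propagator μ E x (propagator μ E (-x) u) = u := by
    intro x u
    rw [← mul_apply_eq_comp, propagator_mul hE, add_neg_cancel, propagator_zero]
    rfl
  have h := integral_product_rule
    (Φ := propagator μ E) (Φ' := fun x => Complex.exp (μ * x) • E)
    (hasDerivAt_propagator μ E) (by fun_prop)
    (((continuous_propagator μ E).comp continuous_neg).clm_apply hm) hint heq
  have heq : ∀ x : ℝ, (Complex.exp (μ * x) • E) (propagator μ E (-x) (m x)) +
      propagator μ E x (propagator μ E (-x) (B x (m x))) = (E + B x) (m x) := by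
    intro x
    rw [hcancel, ← self_mul_propagator hE, mul_apply_eq_comp, hcancel]
    rfl
  simp only [Function.comp_apply] at h
  simp_rw [heq, hcancel] at h
  exact ⟨hm, h⟩

end Propagator

/-! ### Existence and uniqueness with a prescribed limit at -∞ -/

section Jost

theorem tendsto_integral_Iic_atBot {V : Type*} [NormedAddCommGroup V] [NormedSpace ℝ V]
    {f : ℝ → V} {X : ℝ} (hf : IntegrableOn f (Iic X)) :
    Tendsto (fun x => ∫ y in Iic x, f y) atBot (𝓝 0) := by
  have h1 := intervalIntegral_tendsto_integral_Iic X hf tendsto_id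
  have h2 : Tendsto (fun x => (∫ y in Iic X, f y) - ∫ y in x..X, f y) atBot (𝓝 0) := by
    simpa using h1.const_sub (∫ y in Iic X, f y)
  refine h2.congr' ?_
  filter_upwards [eventually_le_atBot X] with x hx
  rw [← intervalIntegral.integral_Iic_sub_Iic (hf.mono_set (Iic_subset_Iic.2 hx)) hf]
  abel

theorem exists_norm_le_of_tendsto_atBot {V : Type*} [NormedAddCommGroup V] {m : ℝ → V}
    {w : V} (hm : Continuous m)
    (hlim : Tendsto m atBot (𝓝 w)) (X : ℝ) : ∃ C, ∀ y ≤ X, ‖m y‖ ≤ C := by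
  obtain ⟨a, ha⟩ := eventually_atBot.1 (hlim.norm.eventually (ge_mem_nhds (lt_add_one ‖w‖)))
  obtain ⟨C, hC⟩ := (isCompact_Icc (a := a) (b := X)).exists_bound_of_continuousOn hm.continuousOn
  refine ⟨max C (‖w‖ + 1), fun y hy => ?_⟩
  rcases le_total y a with h | h
  · exact (ha y h).trans (le_max_right _ _)
  · exact (hC y ⟨h, hy⟩).trans (le_max_left _ _)

variable {V : Type*} [NormedAddCommGroup V] [NormedSpace ℂ V]
  {μ : ℂ} {E : V →L[ℂ] V} {B : ℝ → V →L[ℂ] V} {m : ℝ → V}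

theorem tendsto_propagator_of_ne (hre : μ.re ≤ 0) (hμ : μ ≠ 0)
    (hlim : Tendsto m atBot (𝓝 0)) (x : ℝ) :
    Tendsto (fun a => propagator μ E (x - a) (m a)) atBot (𝓝 0) := by
  have h1 : Tendsto (fun a => (1 + 2 / ‖μ‖ * ‖E‖) * ‖m a‖) atBot (𝓝 0) := by
    simpa using hlim.norm.const_mul (1 + 2 / ‖μ‖ * ‖E‖)
  refine squeeze_zero_norm' ?_ h1
  filter_upwards [eventually_le_atBot x] with a ha
  exact (ContinuousLinearMap.le_opNorm _ _).trans (mul_le_mul_of_nonneg_right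
    (norm_propagator_le (norm_relExp_le_two_div hre hμ (sub_nonneg.2 ha))) (norm_nonneg _))

variable [CompleteSpace V]

/-- The solution of `m' = (E + B(x)) m` with limit `w` at `-∞`. -/
noncomputable def jostSol (μ : ℂ) (E : V →L[ℂ] V) (B : ℝ → V →L[ℂ] V) (w : V) : ℝ → V :=
  volterraSol (jostKernel μ E B) w

theorem jostSol_spec (hE : E * E = μ • E)
    (hK : ∀ X, ∃ h, IsVolterraKernel (jostKernel μ E B) h X) {w : V} (hw : E w = 0) :
    IsODESolution E B (jostSol μ E B w) ∧ Tendsto (jostSol μ E B w) atBot (𝓝 w) := by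
  set m := jostSol μ E B w with hm_def
  have hm : Continuous m := by
    refine continuous_iff_continuousAt.2 fun x => ?_
    obtain ⟨h, hh⟩ := hK (x + 1)
    exact (hh.continuousOn_volterraSol_right (continuous_jostKernel_left μ E B) w).continuousAt
      (Iic_mem_nhds (lt_add_one x))
  have heq : ∀ x, m x = w + ∫ y in Iic x, jostKernel μ E B x y (m y) := by
    intro x
    obtain ⟨h, hh⟩ := hK x
    exact hh.volterraSol_eq (continuous_jostKernel_left μ E B) w le_rfl
  have hbdd : ∀ X, ∃ C, ∀ y ≤ X, ‖m y‖ ≤ C := by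
    intro X
    obtain ⟨h, hh⟩ := hK X
    exact ⟨_, fun y hy => hh.norm_volterraSol_le w hy⟩
  have hint : ∀ x, IntegrableOn (fun y => jostKernel μ E B x y (m y)) (Iic x) := by
    intro x
    obtain ⟨h, hh⟩ := hK x
    obtain ⟨C, hC⟩ := hbdd x
    exact hh.integrableOn_apply hm.continuousOn hC le_rfl
  -- Applying e^{-xE} removes x from the integrand, so differences over two endpoints become
  -- integrals over an interval.
  have hpull : ∀ x y, propagator μ E (-x) (jostKernel μ E B x y (m y)) =
      propagator μ E (-y) (B y (m y)) := by
    intro x y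
    rw [jostKernel, ← mul_apply_eq_comp, ← mul_assoc, propagator_mul hE, neg_add_eq_sub,
      sub_sub_cancel_left]
    rfl
  have hint' : ∀ x, IntegrableOn (fun y => propagator μ E (-y) (B y (m y))) (Iic x) := by
    intro x
    simpa only [hpull, IntegrableOn] using (propagator μ E (-x)).integrable_comp (hint x)
  have heq' : ∀ x, propagator μ E (-x) (m x) =
      w + ∫ y in Iic x, propagator μ E (-y) (B y (m y)) := by
    intro x
    -- Here E w = 0 enters: the propagator fixes `w`.
    rw [heq x, map_add, propagator_apply_of_apply_eq_zero hw,
      ← ContinuousLinearMap.integral_comp_comm _ (hint x)]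
    simp_rw [hpull]
  refine ⟨isODESolution_of_propagator hE hm (fun a b => ?_) fun a b => ?_, ?_⟩
  · exact ⟨(hint' b).mono_set Ioc_subset_Iic_self, (hint' a).mono_set Ioc_subset_Iic_self⟩
  · rw [heq', heq', ← intervalIntegral.integral_Iic_sub_Iic (hint' a) (hint' b)]
    abel
  · obtain ⟨h, hh⟩ := hK 0
    obtain ⟨C, hC⟩ := hbdd 0
    rw [tendsto_iff_norm_sub_tendsto_zero]
    have hlim : Tendsto (fun x => (∫ y in Iic x, h y) * C) atBot (𝓝 0) := by
      simpa using (tendsto_integral_Iic_atBot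
        (hh.integrable.integrableOn (s := Iic 0))).mul_const C
    refine squeeze_zero' (Eventually.of_forall fun x => norm_nonneg _) ?_ hlim
    filter_upwards [eventually_le_atBot 0] with x hx
    rw [heq x, add_sub_cancel_left, ← integral_mul_const]
    refine norm_integral_le_of_norm_le (hh.integrable.integrableOn.mul_const C) ?_
    filter_upwards [ae_restrict_mem measurableSet_Iic] with y hy
    exact hh.norm_apply_le hy hx (hC y (le_trans hy hx))

/-- A solution that decays at `-∞`, also after transport by the free propagator, vanishes. -/
theorem IsODESolution.eq_zero (hE : E * E = μ • E)
    (hK : ∀ X, ∃ h, IsVolterraKernel (jostKernel μ E B) h X) (hm : IsODESolution E B m)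
    (hlim : Tendsto m atBot (𝓝 0))
    (hprop : ∀ x, Tendsto (fun a => propagator μ E (x - a) (m a)) atBot (𝓝 0)) : m = 0 := by
  funext X
  obtain ⟨h, hh⟩ := hK X
  obtain ⟨C, hC⟩ := exists_norm_le_of_tendsto_atBot hm.1 hlim X
  refine hh.eq_zero_of_homogeneous hC (fun x hx => ?_) le_rfl
  have hint := hh.integrableOn_apply hm.1.continuousOn hC hx
  -- Let a → -∞ in Duhamel's formula; the boundary term disappears by `hprop`.
  have h1 := (hprop x).add (intervalIntegral_tendsto_integral_Iic x hint tendsto_id)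
  rw [zero_add] at h1
  refine tendsto_nhds_unique (tendsto_const_nhds.congr fun a => ?_) h1
  exact (hm.duhamel hE a x).2

/-- At a branch point the propagator grows linearly, so m(a) → 0 is not enough. But E² = 0 makes E m
a primitive of E B m vanishing at -∞, and the first moment of `B` compensates the growth. -/
theorem IsODESolution.tendsto_propagator_of_eq_zero (hE : E * E = 0)
    (hB : ∀ X, IntegrableOn (fun y => (1 + |y|) * ‖B y‖) (Iic X))
    (hBm : ∀ X, AEStronglyMeasurable B (volume.restrict (Iic X)))
    (hm : IsODESolution E B m) (hlim : Tendsto m atBot (𝓝 0)) (x : ℝ) :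
    Tendsto (fun a => propagator 0 E (x - a) (m a)) atBot (𝓝 0) := by
  obtain ⟨C, hC⟩ := exists_norm_le_of_tendsto_atBot hm.1 hlim 0
  have hC0 : 0 ≤ C := (norm_nonneg _).trans (hC 0 le_rfl)
  let f : ℝ → V := fun y => E (B y (m y))
  have hfm : AEStronglyMeasurable f (volume.restrict (Iic 0)) :=
    E.continuous.comp_aestronglyMeasurable
      (isBoundedBilinearMap_apply.continuous.comp_aestronglyMeasurable
        ((hBm 0).prodMk hm.1.aestronglyMeasurable))
  have hfle : ∀ y ≤ 0, ‖f y‖ ≤ ‖E‖ * C * ‖B y‖ := fun y hy =>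
    calc ‖f y‖ ≤ ‖E‖ * (‖B y‖ * C) := (E.le_opNorm _).trans (mul_le_mul_of_nonneg_left
          (((B y).le_opNorm _).trans (mul_le_mul_of_nonneg_left (hC y hy) (norm_nonneg _)))
          (norm_nonneg _))
      _ = _ := by ring
  have hfint : IntegrableOn f (Iic 0) := by
    refine Integrable.mono' ((hB 0).const_mul (‖E‖ * C)) hfm ?_
    filter_upwards [ae_restrict_mem measurableSet_Iic] with y hy
    refine (hfle y hy).trans (mul_le_mul_of_nonneg_left ?_ (by positivity))
    nlinarith [norm_nonneg (B y), abs_nonneg y]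
  have hEm : ∀ a ≤ 0, E (m a) = ∫ y in Iic a, f y := by
    intro a ha
    have hstep : ∀ b, E (m a) - E (m b) = ∫ y in b..a, f y := by
      intro b
      rw [← map_sub, (hm.2 b a).2, ← ContinuousLinearMap.intervalIntegral_comp_comm _ (hm.2 b a).1]
      refine intervalIntegral.integral_congr fun y _ => ?_
      have hEE : E (E (m y)) = 0 := by rw [← mul_apply_eq_comp, hE]; rfl
      simp [f, hEE]
    have h1 := intervalIntegral_tendsto_integral_Iic a
      (hfint.mono_set (Iic_subset_Iic.2 ha)) tendsto_id
    have h2 : Tendsto (fun b => E (m a) - E (m b)) atBot (𝓝 (E (m a))) := by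
      simpa using ((E.continuous.tendsto 0).comp hlim).const_sub (E (m a))
    exact tendsto_nhds_unique (h2.congr hstep) h1
  let g : ℝ → ℝ := fun y => (|x| + 1) * (‖E‖ * C) * ((1 + |y|) * ‖B y‖)
  have hgint : IntegrableOn g (Iic 0) := (hB 0).const_mul _
  have hsmall : Tendsto (fun a => ‖m a‖ + ∫ y in Iic a, g y) atBot (𝓝 0) := by
    simpa using hlim.norm.add (tendsto_integral_Iic_atBot hgint)
  refine squeeze_zero_norm' ?_ hsmall
  filter_upwards [eventually_le_atBot 0] with a ha
  have h1 : propagator 0 E (x - a) (m a) = m a + ((x - a : ℝ) : ℂ) • ∫ y in Iic a, f y := by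
    rw [← hEm a ha, propagator, relExp_zero]
    rfl
  rw [h1, ← integral_smul]
  refine (norm_add_le _ _).trans (add_le_add_right ?_ _)
  refine norm_integral_le_of_norm_le (hgint.mono_set (Iic_subset_Iic.2 ha)) ?_
  filter_upwards [ae_restrict_mem measurableSet_Iic] with y hy
  have hy0 : y ≤ 0 := le_trans hy ha
  rw [norm_smul, Complex.norm_real, Real.norm_eq_abs]
  -- The region y ≤ a ≤ 0 gives |a| ≤ |y|, so the growing factor moves under the integral as the
  -- weight 1 + |y|.
  have h2 : |x - a| ≤ (|x| + 1) * (1 + |y|) := by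
    have h3 : |a| ≤ |y| := by
      rw [abs_of_nonpos ha, abs_of_nonpos hy0]
      exact neg_le_neg hy
    nlinarith [abs_sub x a, abs_nonneg x, abs_nonneg y]
  calc |x - a| * ‖f y‖ ≤ (|x| + 1) * (1 + |y|) * (‖E‖ * C * ‖B y‖) := by
        gcongr
        exact hfle y hy0
    _ = g y := by simp only [g]; ring

/-- Uniqueness of the solution with a given limit at `-∞`. -/
theorem eq_jostSol (hE : E * E = μ • E) (hre : μ.re ≤ 0)
    (hK : ∀ X, ∃ h, IsVolterraKernel (jostKernel μ E B) h X)
    (hdecay : μ ≠ 0 ∨ (∀ X, IntegrableOn (fun y => (1 + |y|) * ‖B y‖) (Iic X)) ∧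
      ∀ X, AEStronglyMeasurable B (volume.restrict (Iic X)))
    {w : V} (hw : E w = 0) (hm : IsODESolution E B m) (hlim : Tendsto m atBot (𝓝 w)) :
    m = jostSol μ E B w := by
  obtain ⟨h1, h2⟩ := jostSol_spec hE hK hw
  have h3 : Tendsto (fun x => m x - jostSol μ E B w x) atBot (𝓝 0) := by
    simpa using hlim.sub h2
  have h4 := hm.sub h1
  have h5 : (fun x => m x - jostSol μ E B w x) = 0 := by
    refine h4.eq_zero hE hK h3 fun x => ?_
    by_cases hμ : μ = 0
    · obtain ⟨hB, hBm⟩ := hdecay.resolve_left (not_not.2 hμ)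
      subst hμ
      exact h4.tendsto_propagator_of_eq_zero (by rw [hE, zero_smul]) hB hBm h3 x
    · exact tendsto_propagator_of_ne hre hμ h3 x
  funext x
  exact sub_eq_zero.1 (congrFun h5 x)

end Jost

/-! ### Dependence on parameters -/

section JostParameters

variable {V : Type*} [NormedAddCommGroup V] [NormedSpace ℂ V] {B : ℝ → V →L[ℂ] V}
  {T : Type*} [TopologicalSpace T] {S : Set T} {μ : T → ℂ} {E : T → V →L[ℂ] V}

/-- Only y ≤ X matters, so the majorant is cut off there to be integrable on the whole line. -/
theorem isVolterraKernel_jostKernel {μ : ℂ} {E : V →L[ℂ] V} {X : ℝ} {g : ℝ → ℝ}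
    (hBm : AEStronglyMeasurable B (volume.restrict (Iic X))) (hg : IntegrableOn g (Iic X))
    (hbound : ∀ x y, y ≤ x → x ≤ X → ‖propagator μ E (x - y)‖ * ‖B y‖ ≤ g y) :
    IsVolterraKernel (jostKernel μ E B) ((Iic X).indicator g) X where
  integrable := hg.integrable_indicator measurableSet_Iic
  nonneg y := indicator_nonneg (fun z hz => (by positivity : (0 : ℝ) ≤ _).trans
    (hbound z z le_rfl hz)) y
  bound x y hyx hx := by
    rw [indicator_of_mem (mem_Iic.2 (hyx.trans hx))]
    exact (norm_mul_le _ _).trans (hbound x y hyx hx)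
  meas x hx :=
    ((continuous_propagator μ E).comp (by fun_prop : Continuous fun y => x - y)).aestronglyMeasurable.mul
      (hBm.mono_measure (Measure.restrict_mono (Iic_subset_Iic.2 hx) le_rfl))

/-- The Jost kernels have a common integrable majorant near each point where `μ ≠ 0`. -/
theorem eventually_isVolterraKernel_of_ne (hμ : ContinuousOn μ S) (hE : ContinuousOn E S)
    (hre : ∀ P ∈ S, (μ P).re ≤ 0) (hne : ∀ P ∈ S, μ P ≠ 0)
    (hB : ∀ X, IntegrableOn B (Iic X)) {P₀ : T} (hP₀ : P₀ ∈ S) (X : ℝ) :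
    ∃ h, ∀ᶠ P in 𝓝[S] P₀, IsVolterraKernel (jostKernel (μ P) (E P) B) h X := by
  have hμ0 : 0 < ‖μ P₀‖ := norm_pos_iff.2 (hne P₀ hP₀)
  -- Near P₀ one has |μ| > |μ(P₀)|/2 and ‖E‖ < ‖E(P₀)‖ + 1, so these constants serve a whole
  -- neighbourhood.
  refine ⟨(Iic X).indicator fun y =>
    (1 + 2 / (‖μ P₀‖ / 2) * (‖E P₀‖ + 1)) * ‖B y‖, ?_⟩
  filter_upwards [self_mem_nhdsWithin,
    (hμ P₀ hP₀).norm.eventually (lt_mem_nhds (half_lt_self hμ0)),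
    (hE P₀ hP₀).norm.eventually (gt_mem_nhds (lt_add_one ‖E P₀‖))] with P hP h1 h2
  refine isVolterraKernel_jostKernel (hB X).aestronglyMeasurable ((hB X).norm.const_mul _)
    fun x y hyx _ => mul_le_mul_of_nonneg_right ?_ (norm_nonneg _)
  refine (norm_propagator_le
    (norm_relExp_le_two_div (hre P hP) (hne P hP) (sub_nonneg.2 hyx))).trans ?_
  gcongr

/-- The Jost kernels have a common integrable majorant near each point if the potential has a
finite first moment. -/
theorem eventually_isVolterraKernel_of_weight (hE : ContinuousOn E S)
    (hre : ∀ P ∈ S, (μ P).re ≤ 0)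
    (hB : ∀ X, IntegrableOn (fun y => (1 + |y|) * ‖B y‖) (Iic X))
    (hBm : ∀ X, AEStronglyMeasurable B (volume.restrict (Iic X))) {P₀ : T} (hP₀ : P₀ ∈ S) (X : ℝ) :
    ∃ h, ∀ᶠ P in 𝓝[S] P₀, IsVolterraKernel (jostKernel (μ P) (E P) B) h X := by
  refine ⟨(Iic X).indicator fun y =>
    (1 + (|X| + 1) * (‖E P₀‖ + 1)) * ((1 + |y|) * ‖B y‖), ?_⟩
  filter_upwards [self_mem_nhdsWithin,
    (hE P₀ hP₀).norm.eventually (gt_mem_nhds (lt_add_one ‖E P₀‖))] with P hP h2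
  refine isVolterraKernel_jostKernel (hBm X) ((hB X).const_mul _) fun x y hyx hx => ?_
  rw [← mul_assoc]
  refine mul_le_mul_of_nonneg_right ?_ (norm_nonneg _)
  refine (norm_propagator_le (norm_relExp_le (hre P hP) (sub_nonneg.2 hyx))).trans ?_
  -- As x ≤ X, the growth x - y is at most |X| + |y|; this is why the majorant depends on X.
  have h3 : x - y ≤ (|X| + 1) * (1 + |y|) := by
    nlinarith [le_abs_self X, neg_abs_le y, abs_nonneg X, abs_nonneg y]
  calc 1 + (x - y) * ‖E P‖ ≤ 1 + (|X| + 1) * (1 + |y|) * (‖E P₀‖ + 1) := by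
        gcongr
    _ ≤ (1 + (|X| + 1) * (‖E P₀‖ + 1)) * (1 + |y|) := by
        nlinarith [abs_nonneg y]

theorem continuousOn_jostKernel (hμ : ContinuousOn μ S) (hE : ContinuousOn E S) (X y : ℝ) :
    ContinuousOn (fun p : T × ℝ => jostKernel (μ p.1) (E p.1) B p.2 y) (S ×ˢ Iic X) := by
  have hfst : MapsTo Prod.fst (S ×ˢ Iic X) S := fun p hp => hp.1
  have h1 : ContinuousOn (fun p : T × ℝ => μ p.1) (S ×ˢ Iic X) := hμ.comp continuousOn_fst hfst
  have h2 : ContinuousOn (fun p : T × ℝ => E p.1) (S ×ˢ Iic X) := hE.comp continuousOn_fst hfst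
  have h3 : ContinuousOn (fun p : T × ℝ => relExp (μ p.1) (p.2 - y)) (S ×ˢ Iic X) :=
    continuous_relExp.comp_continuousOn
      (h1.prodMk (by fun_prop : ContinuousOn (fun p : T × ℝ => p.2 - y) (S ×ˢ Iic X)))
  exact (continuousOn_const.add (h3.smul h2)).mul continuousOn_const

theorem differentiableOn_jostKernel {U : Set ℂ} {μ : ℂ → ℂ} {E : ℂ → V →L[ℂ] V}
    (hμ : DifferentiableOn ℂ μ U) (hE : DifferentiableOn ℂ E U) (x y : ℝ) :
    DifferentiableOn ℂ (fun k => jostKernel (μ k) (E k) B x y) U := by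
  have h1 : DifferentiableOn ℂ (fun k => relExp (μ k) (x - y)) U :=
    (differentiable_relExp (x - y)).comp_differentiableOn hμ
  have h2 : DifferentiableOn ℂ (fun k => 1 + relExp (μ k) (x - y) • E k) U :=
    (h1.smul hE).const_add 1
  exact h2.mul_const (B y)

variable [CompleteSpace V]

/-- Continuity is local: shrink to the parameters near P₀ that share one majorant and a bound on
`w`, where the Neumann series converges uniformly. -/
theorem continuousOn_jostSol [FirstCountableTopology T] (hμ : ContinuousOn μ S)
    (hE : ContinuousOn E S) {w : T → V} (hw : ContinuousOn w S)
    (hK : ∀ P₀ ∈ S, ∀ X, ∃ h, ∀ᶠ P in 𝓝[S] P₀, IsVolterraKernel (jostKernel (μ P) (E P) B) h X)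
    (x : ℝ) : ContinuousOn (fun P => jostSol (μ P) (E P) B (w P) x) S := by
  intro P₀ hP₀
  obtain ⟨h, hh⟩ := hK P₀ hP₀ x
  have hw' := (hw P₀ hP₀).norm.eventually (gt_mem_nhds (lt_add_one ‖w P₀‖))
  set S' : Set T := {P | P ∈ S ∧ IsVolterraKernel (jostKernel (μ P) (E P) B) h x ∧
    ‖w P‖ < ‖w P₀‖ + 1} with hS'
  have hmem : S' ∈ 𝓝[S] P₀ := by
    filter_upwards [self_mem_nhdsWithin, hh, hw'] with P h1 h2 h3
    exact ⟨h1, h2, h3⟩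
  have hsub : S' ⊆ S := fun P hP => hP.1
  have hcont := IsVolterraKernel.continuousOn_volterraSol (S := S')
    (Kp := fun P => jostKernel (μ P) (E P) B) (fun P hP => hP.2.1)
    (continuousOn_jostKernel (hμ.mono hsub) (hE.mono hsub) x) (hw.mono hsub)
    fun P hP => hP.2.2.le
  have hcont' : ContinuousOn (fun P => jostSol (μ P) (E P) B (w P) x) S' := by
    have hpair : ContinuousOn (fun P : T => (P, x)) S' := by fun_prop
    have hmaps : MapsTo (fun P : T => (P, x)) S' (S' ×ˢ Iic x) := fun P hP => ⟨hP, le_refl x⟩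
    have hcomp := hcont.comp hpair hmaps
    simp only [Function.comp_def] at hcomp
    exact hcomp
  have hP₀' : P₀ ∈ S' := mem_of_mem_nhdsWithin hP₀ hmem
  exact (hcont' P₀ hP₀').mono_of_mem_nhdsWithin hmem

/-- The same localisation, now to an open set of parameters. -/
theorem differentiableOn_jostSol {U : Set ℂ} (hU : IsOpen U) {μ : ℂ → ℂ} {E : ℂ → V →L[ℂ] V}
    {w : ℂ → V} (hμ : DifferentiableOn ℂ μ U) (hE : DifferentiableOn ℂ E U)
    (hw : DifferentiableOn ℂ w U)
    (hK : ∀ k₀ ∈ U, ∀ X, ∃ h, ∀ᶠ k in 𝓝[U] k₀, IsVolterraKernel (jostKernel (μ k) (E k) B) h X)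
    (x : ℝ) : DifferentiableOn ℂ (fun k => jostSol (μ k) (E k) B (w k) x) U := by
  intro k₀ hk₀
  obtain ⟨h, hh⟩ := hK k₀ hk₀ x
  have hw' := (hw.continuousOn k₀ hk₀).norm.eventually (gt_mem_nhds (lt_add_one ‖w k₀‖))
  rw [hU.nhdsWithin_eq hk₀] at hh hw'
  obtain ⟨U', hU'sub, hU'open, hk₀U'⟩ := eventually_nhds_iff.1 ((hh.and hw').and (hU.mem_nhds hk₀))
  have hsub : U' ⊆ U := fun k hk => (hU'sub k hk).2
  have hdiff := IsVolterraKernel.differentiableOn_volterraSol hU'open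
    (Kc := fun k => jostKernel (μ k) (E k) B) (fun k hk => (hU'sub k hk).1.1)
    (continuousOn_jostKernel (hμ.mono hsub).continuousOn (hE.mono hsub).continuousOn x)
    (fun x y => differentiableOn_jostKernel (hμ.mono hsub) (hE.mono hsub) x y)
    (hw.mono hsub) (fun k hk => (hU'sub k hk).1.2.le) (le_refl x)
  exact (hdiff.differentiableAt (hU'open.mem_nhds hk₀U')).differentiableWithinAt

end JostParameters

/-! ### The branch of λ and the two sheets -/

section Sheets

variable {q₀ : ℝ}

theorem isOpen_compl_cut (q₀ : ℝ) : IsOpen (cut q₀)ᶜ := by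
  have h1 : IsClosed {k : ℂ | k.im = 0} := isClosed_eq Complex.continuous_im continuous_const
  have h2 : IsClosed {k : ℂ | k.re ≤ -q₀} := isClosed_le Complex.continuous_re continuous_const
  have h3 : IsClosed {k : ℂ | q₀ ≤ k.re} := isClosed_le continuous_const Complex.continuous_re
  exact (h1.inter (h2.union h3)).isOpen_compl

theorem sub_mem_slitPlane {k : ℂ} (hk : k ∈ (cut q₀)ᶜ) : (q₀ : ℂ) - k ∈ Complex.slitPlane := by
  rw [Complex.mem_slitPlane_iff]
  by_contra! h
  simp only [Complex.sub_re, Complex.sub_im, Complex.ofReal_re, Complex.ofReal_im, zero_sub,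
    neg_eq_zero, sub_nonpos] at h
  exact hk ⟨h.2, Or.inr h.1⟩

theorem add_mem_slitPlane {k : ℂ} (hk : k ∈ (cut q₀)ᶜ) : k + (q₀ : ℂ) ∈ Complex.slitPlane := by
  rw [Complex.mem_slitPlane_iff]
  by_contra! h
  simp only [Complex.add_re, Complex.add_im, Complex.ofReal_re, Complex.ofReal_im, add_zero] at h
  exact hk ⟨h.2, Or.inl (by linarith)⟩

/-- An angle in [0, 2π) is the principal argument of the opposite point plus π, which moves the jump
to the positive axis. -/
theorem angle₁_eq {z : ℂ} (hz : -z ∈ Complex.slitPlane) : angle₁ z = (-z).arg + Real.pi := by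
  have hz' := Complex.mem_slitPlane_iff.1 hz
  simp only [Complex.neg_re, Complex.neg_im, ne_eq, neg_eq_zero] at hz'
  rw [angle₁]
  rcases lt_trichotomy z.im 0 with h | h | h
  · rw [if_pos (Complex.arg_neg_iff.2 h), Complex.arg_neg_eq_arg_add_pi_of_im_neg h]
    ring
  · have hre : z.re < 0 := by
      rcases hz' with h' | h'
      · linarith
      · exact absurd h h'
    have h1 : z.arg = Real.pi := Complex.arg_eq_pi_iff.2 ⟨hre, h⟩
    have h2 : (-z).arg = 0 := Complex.arg_eq_zero_iff.2 ⟨by simpa using hre.le, by simpa using h⟩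
    rw [h1, h2, if_neg (not_lt.2 Real.pi_pos.le), zero_add]
  · rw [if_neg (not_lt.2 (Complex.arg_nonneg_iff.2 h.le)),
      Complex.arg_neg_eq_arg_sub_pi_of_im_pos h]
    ring

theorem angle₂_eq {z : ℂ} (hz : z ∈ Complex.slitPlane) : angle₂ z = z.arg := by
  rw [angle₂, if_neg (Complex.mem_slitPlane_iff_arg.1 hz).1]

theorem cpow_half_eq {z : ℂ} (hz : z ≠ 0) :
    z ^ (1 / 2 : ℂ) = (Real.sqrt ‖z‖ : ℂ) * Complex.exp (Complex.I * ((z.arg / 2 : ℝ) : ℂ)) := by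
  rw [Complex.cpow_def_of_ne_zero hz, Complex.log, Real.sqrt_eq_rpow,
    Real.rpow_def_of_pos (norm_pos_iff.2 hz), Complex.ofReal_exp, ← Complex.exp_add]
  congr 1
  push_cast
  ring

/-- The extra π in the first angle becomes, after halving, the factor i. Both principal roots are
holomorphic off the cut. -/
theorem lam₁_eq {k : ℂ} (hk : k ∈ (cut q₀)ᶜ) :
    lam₁ q₀ k = Complex.I * (((q₀ : ℂ) - k) ^ (1 / 2 : ℂ) * (k + q₀) ^ (1 / 2 : ℂ)) := by
  have h1 := sub_mem_slitPlane hk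
  have h2 := add_mem_slitPlane hk
  have h3 : -(k - (q₀ : ℂ)) = q₀ - k := by ring
  have hI : Complex.I = Complex.exp (Complex.I * ((Real.pi / 2 : ℝ) : ℂ)) := by
    rw [mul_comm]
    push_cast
    exact Complex.exp_pi_div_two_mul_I.symm
  rw [lam₁, angle₁_eq (by rwa [h3]), angle₂_eq h2, h3,
    cpow_half_eq (Complex.slitPlane_ne_zero h1), cpow_half_eq (Complex.slitPlane_ne_zero h2),
    Real.sqrt_mul (norm_nonneg _), norm_sub_rev k, Complex.ofReal_mul]
  have h4 : Complex.exp (Complex.I * ((((↑q₀ - k).arg + Real.pi + (k + ↑q₀).arg) / 2 : ℝ) : ℂ)) =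
      Complex.exp (Complex.I * ((Real.pi / 2 : ℝ) : ℂ)) *
        (Complex.exp (Complex.I * (((↑q₀ - k).arg / 2 : ℝ) : ℂ)) *
          Complex.exp (Complex.I * (((k + ↑q₀).arg / 2 : ℝ) : ℂ))) := by
    rw [← Complex.exp_add, ← Complex.exp_add]
    congr 1
    push_cast
    ring
  rw [h4, ← hI]
  ring

theorem lam₁_sq {k : ℂ} (hk : k ∈ (cut q₀)ᶜ) : lam₁ q₀ k ^ 2 = k ^ 2 - (q₀ : ℂ) ^ 2 := by
  have h : ∀ z : ℂ, (z ^ (1 / 2 : ℂ)) ^ 2 = z := fun z => by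
    rw [one_div]
    exact Complex.cpow_ofNat_inv_pow z 2
  rw [lam₁_eq hk, mul_pow, mul_pow, h, h, Complex.I_sq]
  ring

/-- The points k - q₀ and k + q₀ have the same imaginary part, so their arguments lie on the same
side of 0 and the half sum of the angles is in [0, π]. -/
theorem lam₁_im_nonneg {k : ℂ} (hk : k ∈ (cut q₀)ᶜ) : 0 ≤ (lam₁ q₀ k).im := by
  have h2 := add_mem_slitPlane hk
  rw [lam₁, Complex.im_ofReal_mul, mul_comm Complex.I, Complex.exp_ofReal_mul_I_im]
  refine mul_nonneg (Real.sqrt_nonneg _) (Real.sin_nonneg_of_nonneg_of_le_pi ?_ ?_)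
  all_goals
    rw [angle₂_eq h2, angle₁]
    have him : (k - (q₀ : ℂ)).im = (k + (q₀ : ℂ)).im := by simp
    have b1 := Complex.arg_le_pi (k - (q₀ : ℂ))
    have b2 := Complex.arg_le_pi (k + (q₀ : ℂ))
    have b3 := Complex.neg_pi_lt_arg (k - (q₀ : ℂ))
    have b4 := Complex.neg_pi_lt_arg (k + (q₀ : ℂ))
    split_ifs with h
    · have h' : (k + (q₀ : ℂ)).arg < 0 := by
        rw [Complex.arg_neg_iff, ← him]
        exact Complex.arg_neg_iff.1 h
      linarith
    · have h' : 0 ≤ (k + (q₀ : ℂ)).arg := by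
        rw [Complex.arg_nonneg_iff, ← him]
        exact Complex.arg_nonneg_iff.1 (not_lt.1 h)
      linarith

theorem differentiableOn_lam₁ (q₀ : ℝ) : DifferentiableOn ℂ (lam₁ q₀) (cut q₀)ᶜ := by
  refine DifferentiableOn.congr (fun k hk => ?_) fun k hk => lam₁_eq hk
  have h1 : DifferentiableAt ℂ (fun k => ((q₀ : ℂ) - k) ^ (1 / 2 : ℂ)) k :=
    (differentiableAt_id.const_sub _).cpow_const (sub_mem_slitPlane hk)
  have h2 : DifferentiableAt ℂ (fun k => (k + (q₀ : ℂ)) ^ (1 / 2 : ℂ)) k :=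
    (differentiableAt_id.add_const _).cpow_const (add_mem_slitPlane hk)
  exact ((h1.mul h2).const_mul _).differentiableWithinAt

/-- Both conditions are closed, so they pass from the open sheet to its closure. Nothing else about
the closed sheet is needed. -/
theorem closedUpperSheet_subset (q₀ : ℝ) :
    closedUpperSheet q₀ ⊆ {P | P.2 ^ 2 = P.1 ^ 2 - (q₀ : ℂ) ^ 2 ∧ 0 ≤ P.2.im} := by
  refine closure_minimal ?_ ((isClosed_eq (by fun_prop) (by fun_prop)).inter
    (isClosed_le continuous_const (Complex.continuous_im.comp continuous_snd)))
  rintro _ ⟨k, hk, rfl⟩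
  exact ⟨lam₁_sq hk, lam₁_im_nonneg hk⟩

theorem closedLowerSheet_subset (q₀ : ℝ) :
    closedLowerSheet q₀ ⊆ {P | P.2 ^ 2 = P.1 ^ 2 - (q₀ : ℂ) ^ 2 ∧ P.2.im ≤ 0} := by
  refine closure_minimal ?_ ((isClosed_eq (by fun_prop) (by fun_prop)).inter
    (isClosed_le (Complex.continuous_im.comp continuous_snd) continuous_const))
  rintro _ ⟨k, hk, rfl⟩
  refine ⟨?_, ?_⟩
  · simp only [lam₂, neg_sq]
    exact lam₁_sq hk
  · simp only [lam₂, Complex.neg_im, neg_nonpos]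
    exact lam₁_im_nonneg hk

theorem mem_branchPoints_of_snd_eq_zero {P : ℂ × ℂ} (hP : P.2 ^ 2 = P.1 ^ 2 - (q₀ : ℂ) ^ 2)
    (h0 : P.2 = 0) : P ∈ branchPoints q₀ := by
  obtain ⟨k, l⟩ := P
  simp only at hP h0
  subst h0
  have h1 : k ^ 2 = (q₀ : ℂ) ^ 2 := by linear_combination -hP
  rcases sq_eq_sq_iff_eq_or_eq_neg.1 h1 with rfl | rfl
  · exact Or.inl rfl
  · exact Or.inr rfl

theorem notMem_branchPoints {k l : ℂ} (hk : k ∈ (cut q₀)ᶜ) : (k, l) ∉ branchPoints q₀ := by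
  rintro (h | h)
  · rw [(Prod.mk.inj h).1] at hk
    exact hk ⟨by simp, Or.inr (by simp)⟩
  · rw [(Prod.mk.inj (mem_singleton_iff.1 h)).1] at hk
    exact hk ⟨by simp, Or.inl (by simp)⟩

theorem mem_closedUpperSheet {k : ℂ} (hk : k ∈ (cut q₀)ᶜ) :
    (k, lam₁ q₀ k) ∈ closedUpperSheet q₀ := subset_closure ⟨k, hk, rfl⟩

theorem mem_closedLowerSheet {k : ℂ} (hk : k ∈ (cut q₀)ᶜ) :
    (k, lam₂ q₀ k) ∈ closedLowerSheet q₀ := subset_closure ⟨k, hk, rfl⟩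

end Sheets

/-! ### The scattering operator and its reflection -/

section OffDiagonal

/-- `v` is a Carathéodory solution of `v' = (ikJ + Q)v` for the potential matrix with off-diagonal
entries `p` and `r`. -/
def IsOffDiagSolution (p r : ℝ → ℂ) (k : ℂ) (v : ℝ → Fin 2 → ℂ) : Prop :=
  Continuous v ∧ ∀ a b : ℝ,
    IntervalIntegrable (fun x => ((Complex.I * k) • J + !![0, p x; r x, 0]) *ᵥ v x) volume a b ∧
      v b - v a = ∫ x in a..b, ((Complex.I * k) • J + !![0, p x; r x, 0]) *ᵥ v x

/-- Reversing x changes the sign of the whole coefficient. Since -(ikJ) = i(-k)J, the form of the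
system is preserved, and the end +∞ becomes -∞. -/
theorem IsOffDiagSolution.comp_neg {p r : ℝ → ℂ} {k : ℂ} {v : ℝ → Fin 2 → ℂ}
    (hv : IsOffDiagSolution p r k v) :
    IsOffDiagSolution (fun x => -p (-x)) (fun x => -r (-x)) (-k) (fun x => v (-x)) := by
  have heq : ∀ x, ((Complex.I * -k) • J + !![0, -p (-x); -r (-x), 0]) *ᵥ v (-x) =
      -(((Complex.I * k) • J + !![0, p (-x); r (-x), 0]) *ᵥ v (-x)) := by
    intro x
    rw [← Matrix.neg_mulVec]
    congr 1
    ext i j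
    fin_cases i <;> fin_cases j <;> simp [J]
  refine ⟨hv.1.comp continuous_neg, fun a b => ?_⟩
  simp_rw [heq]
  refine ⟨?_, ?_⟩
  · have h := ((IntervalIntegrable.iff_comp_neg (by finiteness)).1 (hv.2 (-a) (-b)).1).neg
    rwa [neg_neg, neg_neg] at h
  · rw [intervalIntegral.integral_neg, intervalIntegral.integral_comp_neg
      (fun x => ((Complex.I * k) • J + !![0, p x; r x, 0]) *ᵥ v x), ← (hv.2 (-b) (-a)).2]
    abel

theorem isOffDiagSolution_comp_neg_iff {p r : ℝ → ℂ} {k : ℂ} {v : ℝ → Fin 2 → ℂ} :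
    IsOffDiagSolution (fun x => -p (-x)) (fun x => -r (-x)) (-k) (fun x => v (-x)) ↔
      IsOffDiagSolution p r k v :=
  ⟨fun h => by simpa only [neg_neg] using h.comp_neg, fun h => h.comp_neg⟩

/-- A matrix as a continuous linear operator on `ℂ²`. -/
noncomputable def matCLM (A : Matrix (Fin 2) (Fin 2) ℂ) : (Fin 2 → ℂ) →L[ℂ] (Fin 2 → ℂ) :=
  LinearMap.toContinuousLinearMap (Matrix.toLin' A)

theorem matCLM_apply (A : Matrix (Fin 2) (Fin 2) ℂ) (v : Fin 2 → ℂ) : matCLM A v = A *ᵥ v := by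
  simp [matCLM]

/-- `ikJ + Q_∞ + iλ` for the limit `Q_∞` of the potential with entries `a` and `b`. -/
noncomputable def limitOp (a b k l : ℂ) : (Fin 2 → ℂ) →L[ℂ] (Fin 2 → ℂ) :=
  (Complex.I * k) • matCLM J + matCLM !![0, a; b, 0] + (Complex.I * l) • 1

/-- The operator with off-diagonal entries `f` and `g`. -/
noncomputable def offDiagOp (f g : ℝ → ℂ) (x : ℝ) : (Fin 2 → ℂ) →L[ℂ] (Fin 2 → ℂ) :=
  f x • matCLM !![0, 1; 0, 0] + g x • matCLM !![0, 0; 1, 0]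

theorem limitOp_apply_zero (a b k l : ℂ) (v : Fin 2 → ℂ) :
    limitOp a b k l v 0 = Complex.I * (l - k) * v 0 + a * v 1 := by
  have h1 : limitOp a b k l v = (Complex.I * k) • (J *ᵥ v) + !![0, a; b, 0] *ᵥ v +
      (Complex.I * l) • v := by
    rw [← matCLM_apply, ← matCLM_apply]
    rfl
  rw [h1]
  simp [J, dotProduct, Fin.sum_univ_two]
  ring

theorem limitOp_apply_one (a b k l : ℂ) (v : Fin 2 → ℂ) :
    limitOp a b k l v 1 = b * v 0 + Complex.I * (l + k) * v 1 := by
  have h1 : limitOp a b k l v = (Complex.I * k) • (J *ᵥ v) + !![0, a; b, 0] *ᵥ v +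
      (Complex.I * l) • v := by
    rw [← matCLM_apply, ← matCLM_apply]
    rfl
  rw [h1]
  simp [J, dotProduct, Fin.sum_univ_two]
  ring

/-- With A = ikJ + Q_∞ one has A² = ab - k² = -l², so (A + il)² = 2il (A + il). The eigenvalues are
0 and 2il. -/
theorem limitOp_mul_self {a b k l : ℂ} (h : l ^ 2 = k ^ 2 - a * b) :
    limitOp a b k l * limitOp a b k l = (2 * Complex.I * l) • limitOp a b k l := by
  have hI := Complex.I_sq
  refine ContinuousLinearMap.ext fun v => funext fun i => ?_
  rw [mul_apply_eq_comp, smul_apply, Pi.smul_apply, smul_eq_mul]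
  fin_cases i
  · simp only [Fin.zero_eta, limitOp_apply_zero, limitOp_apply_one]
    linear_combination (v 0) * h + (v 0 * (k ^ 2 - l ^ 2)) * hI
  · simp only [Fin.mk_one, limitOp_apply_zero, limitOp_apply_one]
    linear_combination (v 1) * h + (v 1 * (k ^ 2 - l ^ 2)) * hI

theorem limitOp_apply_eq_zero {a b k l : ℂ} {w : Fin 2 → ℂ}
    (h0 : Complex.I * (l - k) * w 0 + a * w 1 = 0) (h1 : b * w 0 + Complex.I * (l + k) * w 1 = 0) :
    limitOp a b k l w = 0 := by
  funext i
  fin_cases i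
  · exact (limitOp_apply_zero a b k l w).trans h0
  · exact (limitOp_apply_one a b k l w).trans h1

/-- The splitting is valid for any constants; later they are the limits of the entries at -∞. -/
theorem isOffDiagSolution_iff {p r : ℝ → ℂ} {k : ℂ} {v : ℝ → Fin 2 → ℂ} (a b : ℂ) :
    IsOffDiagSolution p r k v ↔
      IsODESolution (limitOp a b k 0) (offDiagOp (fun x => p x - a) fun x => r x - b) v := by
  have heq : ∀ x, ((Complex.I * k) • J + !![0, p x; r x, 0]) *ᵥ v x =
      (limitOp a b k 0 + offDiagOp (fun x => p x - a) (fun x => r x - b) x) (v x) := by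
    intro x
    funext i
    fin_cases i
    · simp [limitOp, offDiagOp, matCLM_apply, J, Matrix.mulVec, dotProduct, Fin.sum_univ_two]
      ring
    · simp [limitOp, offDiagOp, matCLM_apply, J, Matrix.mulVec, dotProduct, Fin.sum_univ_two]
      ring
  simp only [IsOffDiagSolution, IsODESolution, heq]

theorem limitOp_add_smul (a b k l : ℂ) :
    limitOp a b k 0 + (Complex.I * l) • 1 = limitOp a b k l := by
  refine ContinuousLinearMap.ext fun v => ?_
  simp only [limitOp, add_apply, smul_apply, mul_zero, zero_smul, add_zero]

theorem isODESolution_cexp_smul_iff {a b k : ℂ} {B : ℝ → (Fin 2 → ℂ) →L[ℂ] (Fin 2 → ℂ)}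
    {v : ℝ → Fin 2 → ℂ} (l : ℂ) :
    IsODESolution (limitOp a b k l) B (fun x => Complex.exp (Complex.I * l * x) • v x) ↔
      IsODESolution (limitOp a b k 0) B v := by
  refine ⟨fun h => ?_, fun h => ?_⟩
  · have h1 := h.cexp_smul (-(Complex.I * l))
    have h2 : ∀ x : ℝ, Complex.exp (-(Complex.I * l) * x) • Complex.exp (Complex.I * l * x) • v x =
        v x := fun x => by
      rw [smul_smul, ← Complex.exp_add, neg_mul, neg_add_cancel, Complex.exp_zero, one_smul]
    simp_rw [h2] at h1
    rwa [← limitOp_add_smul, neg_smul, add_neg_cancel_right] at h1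
  · have h1 := h.cexp_smul (Complex.I * l)
    rwa [limitOp_add_smul] at h1

theorem norm_offDiagOp_le (f g : ℝ → ℂ) (x : ℝ) :
    ‖offDiagOp f g x‖ ≤ ‖matCLM !![0, 1; 0, 0]‖ * ‖f x‖ + ‖matCLM !![0, 0; 1, 0]‖ * ‖g x‖ := by
  refine (norm_add_le _ _).trans_eq ?_
  rw [norm_smul, norm_smul]
  ring

theorem integrableOn_smul_add_smul {W : Type*} [NormedAddCommGroup W] [NormedSpace ℂ W]
    {f g : ℝ → ℂ} {s : Set ℝ} (hf : IntegrableOn f s) (hg : IntegrableOn g s) (A B : W) :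
    IntegrableOn (fun x => f x • A + g x • B) s :=
  Integrable.add (Integrable.smul_const hf A) (Integrable.smul_const hg B)

theorem integrableOn_offDiagOp {f g : ℝ → ℂ} {s : Set ℝ} (hf : IntegrableOn f s)
    (hg : IntegrableOn g s) : IntegrableOn (offDiagOp f g) s :=
  integrableOn_smul_add_smul hf hg _ _

theorem integrableOn_weight_offDiagOp {f g : ℝ → ℂ} {s : Set ℝ} (hf : IntegrableOn f s)
    (hg : IntegrableOn g s) (hf' : IntegrableOn (fun y => (1 + |y|) * ‖f y‖) s)
    (hg' : IntegrableOn (fun y => (1 + |y|) * ‖g y‖) s) :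
    IntegrableOn (fun y => (1 + |y|) * ‖offDiagOp f g y‖) s := by
  refine Integrable.mono' ((hf'.const_mul ‖matCLM !![0, 1; 0, 0]‖).add
    (hg'.const_mul ‖matCLM !![0, 0; 1, 0]‖)) ?_ (Eventually.of_forall fun y => ?_)
  · exact (by fun_prop : Continuous fun y : ℝ => 1 + |y|).aestronglyMeasurable.mul
      (integrableOn_offDiagOp hf hg).aestronglyMeasurable.norm
  · have h1 : 0 ≤ 1 + |y| := by positivity
    rw [norm_mul, norm_norm, Real.norm_of_nonneg h1]
    refine (mul_le_mul_of_nonneg_left (norm_offDiagOp_le f g y) h1).trans_eq ?_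
    simp only [Pi.add_apply]
    ring

end OffDiagonal

/-! ### The general theorem on Jost solutions -/

section JostSolutions

/-- The conditions on a perturbation with entries `f` and `g` under which the Jost solutions
normalised at `-∞` exist over `S`: integrability near `-∞`, and a finite first moment unless `λ`
has no zero in `S`. -/
def IsAdmissible (f g : ℝ → ℂ) (l : ℂ × ℂ → ℂ) (S : Set (ℂ × ℂ)) : Prop :=
  (∀ X, IntegrableOn f (Iic X)) ∧ (∀ X, IntegrableOn g (Iic X)) ∧
    ((∀ P ∈ S, l P ≠ 0) ∨ (∀ X, IntegrableOn (fun y => (1 + |y|) * ‖f y‖) (Iic X)) ∧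
      ∀ X, IntegrableOn (fun y => (1 + |y|) * ‖g y‖) (Iic X))

variable {p r : ℝ → ℂ} {a b : ℂ} {S : Set (ℂ × ℂ)} {κ l : ℂ × ℂ → ℂ} {w : ℂ × ℂ → Fin 2 → ℂ}

theorem IsAdmissible.eventually_isVolterraKernel
    (hadm : IsAdmissible (fun x => p x - a) (fun x => r x - b) l S)
    {T : Type*} [TopologicalSpace T] {c : T → ℂ × ℂ} {U : Set T} (hc : ContinuousOn c U)
    (hcS : MapsTo c U S) (hκ : Continuous κ) (hl : Continuous l)
    (him : ∀ P ∈ S, 0 ≤ (l P).im) (t₀ : T) (ht₀ : t₀ ∈ U) (X : ℝ) :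
    ∃ h, ∀ᶠ t in 𝓝[U] t₀, IsVolterraKernel (jostKernel (2 * Complex.I * l (c t))
      (limitOp a b (κ (c t)) (l (c t))) (offDiagOp (fun x => p x - a) fun x => r x - b)) h X := by
  have hκc : ContinuousOn (fun t => κ (c t)) U := hκ.comp_continuousOn hc
  have hlc : ContinuousOn (fun t => l (c t)) U := hl.comp_continuousOn hc
  have hE : ContinuousOn (fun t => limitOp a b (κ (c t)) (l (c t))) U :=
    (((continuousOn_const.mul hκc).smul continuousOn_const).add continuousOn_const).add
      ((continuousOn_const.mul hlc).smul continuousOn_const)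
  have hre : ∀ t ∈ U, (2 * Complex.I * l (c t)).re ≤ 0 := by
    intro t ht
    have := him _ (hcS ht)
    simp [Complex.mul_re]
    linarith
  have hB := fun X => integrableOn_offDiagOp (hadm.1 X) (hadm.2.1 X)
  rcases hadm.2.2 with hne | ⟨hf, hg⟩
  · exact eventually_isVolterraKernel_of_ne (μ := fun t => 2 * Complex.I * l (c t))
      (continuousOn_const.mul hlc) hE hre
      (fun t ht => mul_ne_zero (mul_ne_zero two_ne_zero Complex.I_ne_zero) (hne _ (hcS ht))) hB ht₀ X
  · exact eventually_isVolterraKernel_of_weight (μ := fun t => 2 * Complex.I * l (c t)) hE hre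
      (fun X => integrableOn_weight_offDiagOp (hadm.1 X) (hadm.2.1 X) (hf X) (hg X))
      (fun X => (hB X).aestronglyMeasurable) ht₀ X

/-- The Jost solution at `-∞`, without its exponential factor. -/
noncomputable def leftJost (p r : ℝ → ℂ) (a b k l : ℂ) (w : Fin 2 → ℂ) : ℝ → Fin 2 → ℂ :=
  jostSol (2 * Complex.I * l) (limitOp a b k l) (offDiagOp (fun x => p x - a) fun x => r x - b) w

/-- Existence and uniqueness in one equivalence: the Neumann series meets the conditions, and by
`eq_jostSol` nothing else does. -/
theorem isOffDiagSolution_and_tendsto_iff (hκ : Continuous κ) (hl : Continuous l)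
    (hcurve : ∀ P ∈ S, l P ^ 2 = κ P ^ 2 - a * b) (him : ∀ P ∈ S, 0 ≤ (l P).im)
    (hw : ∀ P ∈ S, limitOp a b (κ P) (l P) (w P) = 0)
    (hadm : IsAdmissible (fun x => p x - a) (fun x => r x - b) l S) {P : ℂ × ℂ} (hP : P ∈ S)
    (v : ℝ → Fin 2 → ℂ) :
    IsOffDiagSolution p r (κ P) v ∧
        Tendsto (fun x : ℝ => Complex.exp (Complex.I * l P * x) • v x) atBot (𝓝 (w P)) ↔
      ∀ x : ℝ, Complex.exp (Complex.I * l P * x) • v x = leftJost p r a b (κ P) (l P) (w P) x := by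
  have hE := limitOp_mul_self (hcurve P hP)
  have hK : ∀ X, ∃ h, IsVolterraKernel (jostKernel (2 * Complex.I * l P)
      (limitOp a b (κ P) (l P)) (offDiagOp (fun x => p x - a) fun x => r x - b)) h X := by
    intro X
    obtain ⟨h, hh⟩ := hadm.eventually_isVolterraKernel (c := id) continuousOn_id (mapsTo_id S)
      hκ hl him P hP X
    exact ⟨h, hh.self_of_nhdsWithin hP⟩
  rw [isOffDiagSolution_iff a b, ← isODESolution_cexp_smul_iff (l P)]
  constructor
  · rintro ⟨h1, h2⟩ x
    have hre : (2 * Complex.I * l P).re ≤ 0 := by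
      have := him P hP
      simp [Complex.mul_re]
      linarith
    refine congrFun (eq_jostSol hE hre hK ?_ (hw P hP) h1 h2) x
    rcases hadm.2.2 with hne | ⟨hf, hg⟩
    · exact Or.inl (mul_ne_zero (mul_ne_zero two_ne_zero Complex.I_ne_zero) (hne P hP))
    · exact Or.inr
        ⟨fun X => integrableOn_weight_offDiagOp (hadm.1 X) (hadm.2.1 X) (hf X) (hg X),
          fun X => (integrableOn_offDiagOp (hadm.1 X) (hadm.2.1 X)).aestronglyMeasurable⟩
  · intro h
    rw [show (fun x : ℝ => Complex.exp (Complex.I * l P * x) • v x) =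
      leftJost p r a b (κ P) (l P) (w P) from funext h]
    exact jostSol_spec hE hK (hw P hP)

/-- Existence, uniqueness, continuity and analyticity of Jost solutions. The involution `s` is the
identity for normalisation at `-∞` and the reflection for normalisation at `+∞`. -/
theorem existsUnique_continuousOn_analyticOnNhd (hκ : Differentiable ℂ κ) (hl : Differentiable ℂ l)
    (hwd : Differentiable ℂ w)
    (hcurve : ∀ P ∈ S, l P ^ 2 = κ P ^ 2 - a * b) (him : ∀ P ∈ S, 0 ≤ (l P).im)
    (hw0 : ∀ P ∈ S, Complex.I * (l P - κ P) * w P 0 + a * w P 1 = 0)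
    (hw1 : ∀ P ∈ S, b * w P 0 + Complex.I * (l P + κ P) * w P 1 = 0)
    (hadm : IsAdmissible (fun x => p x - a) (fun x => r x - b) l S)
    {s : ℝ → ℝ} (hs : Function.Involutive s) {Is : ℂ × ℂ → (ℝ → Fin 2 → ℂ) → Prop}
    (hIs : ∀ P φ, Is P φ ↔ IsOffDiagSolution p r (κ P) (fun x => φ (s x)) ∧
      Tendsto (fun x : ℝ => Complex.exp (Complex.I * l P * x) • φ (s x)) atBot (𝓝 (w P)))
    {c : ℂ → ℂ × ℂ} {U : Set ℂ} (hU : IsOpen U) (hc : DifferentiableOn ℂ c U)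
    (hcS : MapsTo c U S) :
    (∀ P ∈ S, ∃! φ, Is P φ) ∧ ∀ x,
      ContinuousOn (fun P => Complex.exp (Complex.I * l P * s x) • Classical.epsilon (Is P) x) S ∧
      AnalyticOnNhd ℂ (fun k => Complex.exp (Complex.I * l (c k) * s x) •
        Classical.epsilon (Is (c k)) x) U := by
  have hw : ∀ P ∈ S, limitOp a b (κ P) (l P) (w P) = 0 := fun P hP =>
    limitOp_apply_eq_zero (hw0 P hP) (hw1 P hP)
  have hiff : ∀ P ∈ S, ∀ φ, Is P φ ↔ ∀ x : ℝ, Complex.exp (Complex.I * l P * s x) • φ x =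
      leftJost p r a b (κ P) (l P) (w P) (s x) := by
    intro P hP φ
    rw [hIs, isOffDiagSolution_and_tendsto_iff hκ.continuous hl.continuous hcurve him hw hadm hP]
    refine ⟨fun h x => ?_, fun h x => ?_⟩
    · simpa only [hs x] using h (s x)
    · simpa only [hs x] using h (s x)
  have hex : ∀ P ∈ S, ∃! φ, Is P φ := by
    intro P hP
    refine ⟨fun x => Complex.exp (-(Complex.I * l P * s x)) •
      leftJost p r a b (κ P) (l P) (w P) (s x), (hiff P hP _).2 fun x => ?_, fun φ hφ => ?_⟩
    · rw [smul_smul, ← Complex.exp_add, add_neg_cancel, Complex.exp_zero, one_smul]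
    · funext x
      rw [← (hiff P hP φ).1 hφ x, smul_smul, ← Complex.exp_add, neg_add_cancel, Complex.exp_zero,
        one_smul]
  -- By uniqueness the solution chosen by `Classical.epsilon` is the Neumann series, so its
  -- regularity in P is inherited.
  have heps : ∀ P ∈ S, ∀ x : ℝ, Complex.exp (Complex.I * l P * s x) • Classical.epsilon (Is P) x =
      leftJost p r a b (κ P) (l P) (w P) (s x) := fun P hP =>
    (hiff P hP _).1 (Classical.epsilon_spec (hex P hP).exists)
  have hEc : ∀ {U : Set (ℂ × ℂ)}, ContinuousOn (fun P => limitOp a b (κ P) (l P)) U := fun {U} =>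
    (((continuous_const.mul hκ.continuous).smul continuous_const).add continuous_const).add
      ((continuous_const.mul hl.continuous).smul continuous_const) |>.continuousOn
  refine ⟨hex, fun x => ⟨?_, ?_⟩⟩
  · have h1 := continuousOn_jostSol (B := offDiagOp (fun x => p x - a) fun x => r x - b)
      (μ := fun P => 2 * Complex.I * l P) (E := fun P => limitOp a b (κ P) (l P))
      (continuous_const.mul hl.continuous).continuousOn hEc hwd.continuous.continuousOn
      (hadm.eventually_isVolterraKernel (c := id) continuousOn_id (mapsTo_id S)
        hκ.continuous hl.continuous him) (s x)
    exact h1.congr fun P hP => heps P hP x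
  · have hκc : DifferentiableOn ℂ (fun k => κ (c k)) U := hκ.comp_differentiableOn hc
    have hlc : DifferentiableOn ℂ (fun k => l (c k)) U := hl.comp_differentiableOn hc
    have hE : DifferentiableOn ℂ (fun k => limitOp a b (κ (c k)) (l (c k))) U :=
      (((hκc.const_mul Complex.I).smul_const (matCLM J)).add_const (matCLM !![0, a; b, 0])).add
        ((hlc.const_mul Complex.I).smul_const 1)
    have h1 := differentiableOn_jostSol (B := offDiagOp (fun x => p x - a) fun x => r x - b) hU
      (hlc.const_mul (2 * Complex.I)) hE (hwd.comp_differentiableOn hc)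
      (hadm.eventually_isVolterraKernel hc.continuousOn hcS hκ.continuous hl.continuous him) (s x)
    exact (h1.congr fun k hk => heps (c k) (hcS hk) x).analyticOnNhd hU

end JostSolutions

/-! ### Integrability conditions at the two ends -/

section HalfLines

theorem integrableOn_comp_neg {V : Type*} [NormedAddCommGroup V] {f : ℝ → V} {s : Set ℝ}
    (hf : IntegrableOn f s) : IntegrableOn (fun x => f (-x)) (Neg.neg ⁻¹' s) :=
  ((Measure.measurePreserving_neg (volume : Measure ℝ)).integrableOn_comp_preimage
    (MeasurableEquiv.neg ℝ).measurableEmbedding).2 hf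

/-- `p` tends to `a` at `-∞` and to `b` at `+∞` in the `L¹` sense. -/
def HasL1Ends (p : ℝ → ℂ) (a b : ℂ) : Prop :=
  IntegrableOn (fun x => p x - a) (Iic 0) ∧ IntegrableOn (fun x => p x - b) (Ici 0)

/-- `p` tends to `a` at `-∞` and to `b` at `+∞` in the weighted sense of `L^{1,2}`. -/
def HasL12Ends (p : ℝ → ℂ) (a b : ℂ) : Prop :=
  IntegrableOn (fun x => ‖p x - a‖ * (1 + |x|) ^ 2) (Iic 0) ∧
    IntegrableOn (fun x => ‖p x - b‖ * (1 + |x|) ^ 2) (Ici 0)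

variable {p : ℝ → ℂ} {a b : ℂ}

theorem HasL1Ends.reflect (h : HasL1Ends p a b) : HasL1Ends (fun x => -p (-x)) (-b) (-a) := by
  have h1 := (integrableOn_comp_neg h.1).neg
  have h2 := (integrableOn_comp_neg h.2).neg
  refine ⟨?_, ?_⟩
  · convert! h2 using 1
    · funext x
      simp only [Pi.neg_apply]
      ring
    · ext x
      simp
  · convert! h1 using 1
    · funext x
      simp only [Pi.neg_apply]
      ring
    · ext x
      simp

theorem HasL12Ends.reflect (h : HasL12Ends p a b) : HasL12Ends (fun x => -p (-x)) (-b) (-a) := by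
  have h1 := integrableOn_comp_neg h.1
  have h2 := integrableOn_comp_neg h.2
  have hn : ∀ z w : ℂ, ‖-z - -w‖ = ‖z - w‖ := fun z w => by rw [← norm_neg (z - w)]; congr 1; ring
  refine ⟨?_, ?_⟩
  · convert! h2 using 1
    · funext x
      rw [hn, abs_neg]
    · ext x
      simp
  · convert! h1 using 1
    · funext x
      rw [hn, abs_neg]
    · ext x
      simp

/-- On [0, X] the wrong limit differs from the right one by a constant, which is integrable on a
bounded interval. -/
theorem HasL1Ends.integrableOn_Iic (h : HasL1Ends p a b) (X : ℝ) :
    IntegrableOn (fun x => p x - a) (Iic X) := by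
  have h1 : IntegrableOn (fun x => (p x - b) + (b - a)) (Icc 0 X) :=
    (h.2.mono_set Icc_subset_Ici_self).add (integrableOn_const (by simp))
  simp only [sub_add_sub_cancel] at h1
  refine (h.1.union h1).mono_set fun x hx => ?_
  rcases le_total x 0 with h0 | h0
  · exact Or.inl h0
  · exact Or.inr ⟨h0, hx⟩

/-- On the negative axis 1 + |y| ≤ (1 + |y|)²; on [0, X] the weight is bounded. -/
theorem HasL12Ends.integrableOn_weight_Iic (h : HasL12Ends p a b) (h' : HasL1Ends p a b) (X : ℝ) :
    IntegrableOn (fun y => (1 + |y|) * ‖p y - a‖) (Iic X) := by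
  have hm : AEStronglyMeasurable (fun y => (1 + |y|) * ‖p y - a‖) (volume.restrict (Iic X)) :=
    (by fun_prop : Continuous fun y : ℝ => 1 + |y|).aestronglyMeasurable.mul
      (h'.integrableOn_Iic X).aestronglyMeasurable.norm
  have hnorm : ∀ y, ‖(1 + |y|) * ‖p y - a‖‖ = (1 + |y|) * ‖p y - a‖ := fun y =>
    Real.norm_of_nonneg (by positivity)
  have h0 : IntegrableOn (fun y => (1 + |y|) * ‖p y - a‖) (Iic X ∩ Iic 0) := by
    refine Integrable.mono' (h.1.mono_set inter_subset_right)
      (hm.mono_measure (Measure.restrict_mono inter_subset_left le_rfl))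
      (Eventually.of_forall fun y => ?_)
    rw [hnorm, mul_comm]
    refine mul_le_mul_of_nonneg_left ?_ (norm_nonneg _)
    nlinarith [abs_nonneg y]
  have h1 : IntegrableOn (fun y => (1 + |y|) * ‖p y - a‖) (Iic X ∩ Ici 0) := by
    refine Integrable.mono' ((((h'.integrableOn_Iic X).mono_set
      (inter_subset_left (t := Ici 0))).norm).const_mul (1 + |X|))
      (hm.mono_measure (Measure.restrict_mono inter_subset_left le_rfl)) ?_
    filter_upwards [ae_restrict_mem (measurableSet_Iic.inter measurableSet_Ici)] with y hy
    rw [hnorm]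
    gcongr
    exact hy.2
    exact hy.1
  refine (h0.union h1).mono_set fun x hx => ?_
  rcases le_total x 0 with h0 | h0
  · exact Or.inl ⟨hx, h0⟩
  · exact Or.inr ⟨hx, h0⟩

theorem isAdmissible_of_ends {r : ℝ → ℂ} {a' b' : ℂ} {l : ℂ × ℂ → ℂ} {S : Set (ℂ × ℂ)}
    (hp : HasL1Ends p a b) (hr : HasL1Ends r a' b')
    (h : (∀ P ∈ S, l P ≠ 0) ∨ HasL12Ends p a b ∧ HasL12Ends r a' b') :
    IsAdmissible (fun x => p x - a) (fun x => r x - a') l S :=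
  ⟨hp.integrableOn_Iic, hr.integrableOn_Iic,
    h.imp_right fun h => ⟨h.1.integrableOn_weight_Iic hp, h.2.integrableOn_weight_Iic hr⟩⟩

theorem MemL12On.integrableOn {f : ℝ → ℂ} {s : Set ℝ} (hf : MemL12On f s) : IntegrableOn f s := by
  refine Integrable.mono' hf.2 hf.1 (Eventually.of_forall fun x => ?_)
  refine le_mul_of_one_le_right (norm_nonneg _) ?_
  nlinarith [abs_nonneg x]

end HalfLines

/-! ### The four Jost functions -/

section Potential

variable {q₀ α θp θm : ℝ} {q : ℝ → ℝ → ℂ} {t : ℝ}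

theorem PotentialL12.potentialL1 (h : PotentialL12 q₀ α θp θm q t) :
    PotentialL1 q₀ α θp θm q t :=
  fun i j => ⟨(h i j).1.integrableOn, (h i j).2.integrableOn⟩

theorem PotentialL1.upper (h : PotentialL1 q₀ α θp θm q t) :
    HasL1Ends (fun x => q x t) (qInf q₀ α θm t) (qInf q₀ α θp t) := by
  simpa [Q, Qminus, Qplus, HasL1Ends] using h 0 1

theorem PotentialL1.lower (h : PotentialL1 q₀ α θp θm q t) :
    HasL1Ends (fun x => q (-x) (-t)) (qInf q₀ α θp (-t)) (qInf q₀ α θm (-t)) := by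
  simpa [Q, Qminus, Qplus, HasL1Ends] using h 1 0

theorem PotentialL12.upper (h : PotentialL12 q₀ α θp θm q t) :
    HasL12Ends (fun x => q x t) (qInf q₀ α θm t) (qInf q₀ α θp t) := by
  have h1 := h 0 1
  simpa [Q, Qminus, Qplus, HasL12Ends] using And.intro h1.1.2 h1.2.2

theorem PotentialL12.lower (h : PotentialL12 q₀ α θp θm q t) :
    HasL12Ends (fun x => q (-x) (-t)) (qInf q₀ α θp (-t)) (qInf q₀ α θm (-t)) := by
  have h1 := h 1 0
  simpa [Q, Qminus, Qplus, HasL12Ends] using And.intro h1.1.2 h1.2.2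

/-- The phases αt and -αt cancel and the angles add up to a multiple of 2π. This makes λ² = k² - q₀²
the characteristic equation at both ends. -/
theorem qInf_mul_qInf (q₀ α t : ℝ) {θ θ' : ℝ} (hθ : ∃ n : ℤ, θ + θ' = n * (2 * Real.pi)) :
    qInf q₀ α θ t * qInf q₀ α θ' (-t) = (q₀ : ℂ) ^ 2 := by
  obtain ⟨n, hn⟩ := hθ
  have h1 : Complex.exp (Complex.I * ((α * t + θ : ℝ) : ℂ)) *
      Complex.exp (Complex.I * ((α * -t + θ' : ℝ) : ℂ)) = 1 := by
    rw [← Complex.exp_add, ← mul_add, ← Complex.ofReal_add,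
      show α * t + θ + (α * -t + θ') = n * (2 * Real.pi) by rw [← hn]; ring]
    rw [Complex.exp_eq_one_iff]
    exact ⟨n, by push_cast; ring⟩
  rw [qInf, qInf]
  linear_combination (q₀ : ℂ) ^ 2 * h1

theorem tendsto_atTop_iff_comp_neg_atBot {V : Type*} [TopologicalSpace V] {f : ℝ → V} {L : V} :
    Tendsto f atTop (𝓝 L) ↔ Tendsto (fun x => f (-x)) atBot (𝓝 L) :=
  ⟨fun h => h.comp tendsto_neg_atBot_atTop, fun h => by
    simpa only [Function.comp_def, neg_neg] using h.comp tendsto_neg_atTop_atBot⟩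

/-- The potential is `L¹` at both ends, and `L^{1,2}` unless `S` avoids the branch points. -/
def PotentialCondition (q₀ α θp θm : ℝ) (q : ℝ → ℝ → ℂ) (t : ℝ) (S : Set (ℂ × ℂ)) : Prop :=
  PotentialL1 q₀ α θp θm q t ∧ ((∀ P ∈ S, P.2 ≠ 0) ∨ PotentialL12 q₀ α θp θm q t)

variable {S : Set (ℂ × ℂ)}

theorem PotentialCondition.admissible_left (h : PotentialCondition q₀ α θp θm q t S)
    {l : ℂ × ℂ → ℂ} (hl : ∀ P, P.2 ≠ 0 → l P ≠ 0) :
    IsAdmissible (fun x => q x t - qInf q₀ α θm t)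
      (fun x => q (-x) (-t) - qInf q₀ α θp (-t)) l S :=
  isAdmissible_of_ends h.1.upper h.1.lower
    (h.2.imp (fun h P hP => hl P (h P hP)) fun h => ⟨h.upper, h.lower⟩)

theorem PotentialCondition.admissible_right (h : PotentialCondition q₀ α θp θm q t S)
    {l : ℂ × ℂ → ℂ} (hl : ∀ P, P.2 ≠ 0 → l P ≠ 0) :
    IsAdmissible (fun x => -q (-x) t - -qInf q₀ α θp t)
      (fun x => -q (- -x) (-t) - -qInf q₀ α θm (-t)) l S :=
  isAdmissible_of_ends h.1.upper.reflect h.1.lower.reflect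
    (h.2.imp (fun h P hP => hl P (h P hP)) fun h => ⟨h.upper.reflect, h.lower.reflect⟩)

theorem differentiable_vecCons {f g : ℂ × ℂ → ℂ} (hf : Differentiable ℂ f)
    (hg : Differentiable ℂ g) : Differentiable ℂ fun P => ![f P, g P] := by
  refine differentiable_pi.2 fun i => ?_
  fin_cases i
  · exact hf
  · exact hg

theorem differentiableOn_upperSheet_section (q₀ : ℝ) :
    DifferentiableOn ℂ (fun k => (k, lam₁ q₀ k)) (cut q₀)ᶜ :=
  differentiableOn_id.prodMk (differentiableOn_lam₁ q₀)

theorem differentiableOn_lowerSheet_section (q₀ : ℝ) :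
    DifferentiableOn ℂ (fun k => (k, lam₂ q₀ k)) (cut q₀)ᶜ :=
  differentiableOn_id.prodMk (differentiableOn_lam₁ q₀).neg

/-- The model case: no sign change and no reflection. That E annihilates the limit vector is the
curve equation in the first row and i² = -1 in the second. -/
theorem jost_phi (hθ : ∃ n : ℤ, θp + θm = n * (2 * Real.pi))
    (hpot : PotentialCondition q₀ α θp θm q t S) (hS : S ⊆ closedUpperSheet q₀)
    (hcS : ∀ k ∈ (cut q₀)ᶜ, (k, lam₁ q₀ k) ∈ S) :
    (∀ P ∈ S, ∃! φ, IsPhi q₀ α θp q t P φ) ∧ ∀ x, ContinuousOn (M q₀ α θp q t x) S ∧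
      AnalyticOnNhd ℂ (fun k => M q₀ α θp q t x (k, lam₁ q₀ k)) (cut q₀)ᶜ := by
  have hab : qInf q₀ α θm t * qInf q₀ α θp (-t) = (q₀ : ℂ) ^ 2 :=
    qInf_mul_qInf q₀ α t (by simpa only [add_comm] using hθ)
  have hcurve : ∀ P ∈ S, P.2 ^ 2 = P.1 ^ 2 - (q₀ : ℂ) ^ 2 := fun P hP =>
    (closedUpperSheet_subset q₀ (hS hP)).1
  exact existsUnique_continuousOn_analyticOnNhd (κ := Prod.fst) (l := Prod.snd)
    (w := fun P => ![P.2 + P.1, Complex.I * qInf q₀ α θp (-t)]) differentiable_fst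
    differentiable_snd (differentiable_vecCons (by fun_prop) (by fun_prop))
    (fun P hP => by rw [hab]; exact hcurve P hP)
    (fun P hP => (closedUpperSheet_subset q₀ (hS hP)).2)
    (fun P hP => by
      simp only [Matrix.cons_val_zero, Matrix.cons_val_one]
      linear_combination Complex.I * hcurve P hP + Complex.I * hab)
    (fun P hP => by
      simp only [Matrix.cons_val_zero, Matrix.cons_val_one]
      linear_combination (P.2 + P.1) * qInf q₀ α θp (-t) * Complex.I_sq)
    (hpot.admissible_left fun P hP => hP) (s := id) (fun x => rfl) (fun P φ => Iff.rfl)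
    (isOpen_compl_cut q₀) (differentiableOn_upperSheet_section q₀) hcS

/-- The general theorem with -λ in place of λ, which has nonnegative imaginary part on the lower
sheet. -/
theorem jost_phiBar (hθ : ∃ n : ℤ, θp + θm = n * (2 * Real.pi))
    (hpot : PotentialCondition q₀ α θp θm q t S) (hS : S ⊆ closedLowerSheet q₀)
    (hcS : ∀ k ∈ (cut q₀)ᶜ, (k, lam₂ q₀ k) ∈ S) :
    (∀ P ∈ S, ∃! φ, IsPhiBar q₀ α θm q t P φ) ∧ ∀ x, ContinuousOn (MBar q₀ α θm q t x) S ∧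
      AnalyticOnNhd ℂ (fun k => MBar q₀ α θm q t x (k, lam₂ q₀ k)) (cut q₀)ᶜ := by
  have hab : qInf q₀ α θm t * qInf q₀ α θp (-t) = (q₀ : ℂ) ^ 2 :=
    qInf_mul_qInf q₀ α t (by simpa only [add_comm] using hθ)
  have hcurve : ∀ P ∈ S, P.2 ^ 2 = P.1 ^ 2 - (q₀ : ℂ) ^ 2 := fun P hP =>
    (closedLowerSheet_subset q₀ (hS hP)).1
  have key := existsUnique_continuousOn_analyticOnNhd (κ := Prod.fst) (l := fun P => -P.2)
    (w := fun P => ![-(Complex.I * qInf q₀ α θm t), P.2 + P.1]) differentiable_fst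
    differentiable_snd.neg (differentiable_vecCons (by fun_prop) (by fun_prop))
    (fun P hP => by rw [hab, neg_sq]; exact hcurve P hP)
    (fun P hP => by
      rw [Complex.neg_im, neg_nonneg]
      exact (closedLowerSheet_subset q₀ (hS hP)).2)
    (fun P hP => by
      simp only [Matrix.cons_val_zero, Matrix.cons_val_one]
      linear_combination (P.2 + P.1) * qInf q₀ α θm t * Complex.I_sq)
    (fun P hP => by
      simp only [Matrix.cons_val_zero, Matrix.cons_val_one]
      linear_combination -Complex.I * hcurve P hP - Complex.I * hab)
    (hpot.admissible_left fun P hP => neg_ne_zero.2 hP) (s := id) (fun x => rfl)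
    (Is := IsPhiBar q₀ α θm q t)
    (fun P φ => by simp only [mul_neg, neg_mul]; exact Iff.rfl)
    (isOpen_compl_cut q₀) (differentiableOn_lowerSheet_section q₀) hcS
  simp only [mul_neg, neg_mul] at key
  exact key

/-- The general theorem after x → -x and k → -k, with λ unchanged. -/
theorem jost_psi (hθ : ∃ n : ℤ, θp + θm = n * (2 * Real.pi))
    (hpot : PotentialCondition q₀ α θp θm q t S) (hS : S ⊆ closedUpperSheet q₀)
    (hcS : ∀ k ∈ (cut q₀)ᶜ, (k, lam₁ q₀ k) ∈ S) :
    (∀ P ∈ S, ∃! φ, IsPsi q₀ α θp q t P φ) ∧ ∀ x, ContinuousOn (N q₀ α θp q t x) S ∧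
      AnalyticOnNhd ℂ (fun k => N q₀ α θp q t x (k, lam₁ q₀ k)) (cut q₀)ᶜ := by
  have hab : -qInf q₀ α θp t * -qInf q₀ α θm (-t) = (q₀ : ℂ) ^ 2 := by
    rw [neg_mul_neg]
    exact qInf_mul_qInf q₀ α t hθ
  have hcurve : ∀ P ∈ S, P.2 ^ 2 = P.1 ^ 2 - (q₀ : ℂ) ^ 2 := fun P hP =>
    (closedUpperSheet_subset q₀ (hS hP)).1
  have key := existsUnique_continuousOn_analyticOnNhd (κ := fun P => -P.1) (l := Prod.snd)
    (w := fun P => ![-(Complex.I * qInf q₀ α θp t), P.2 + P.1]) differentiable_fst.neg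
    differentiable_snd (differentiable_vecCons (by fun_prop) (by fun_prop))
    (fun P hP => by rw [hab, neg_sq]; exact hcurve P hP)
    (fun P hP => (closedUpperSheet_subset q₀ (hS hP)).2)
    (fun P hP => by
      simp only [Matrix.cons_val_zero, Matrix.cons_val_one]
      linear_combination -(P.2 + P.1) * qInf q₀ α θp t * Complex.I_sq)
    (fun P hP => by
      simp only [Matrix.cons_val_zero, Matrix.cons_val_one]
      linear_combination Complex.I * hcurve P hP + Complex.I * hab)
    (hpot.admissible_right fun P hP => hP) (s := Neg.neg) neg_neg
    (Is := IsPsi q₀ α θp q t)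
    (fun P φ => by
      rw [isOffDiagSolution_comp_neg_iff (p := fun x => q x t) (r := fun x => q (-x) (-t)),
        IsPsi, tendsto_atTop_iff_comp_neg_atBot]
      simp only [Complex.ofReal_neg, mul_neg, neg_neg]
      exact Iff.rfl)
    (isOpen_compl_cut q₀) (differentiableOn_upperSheet_section q₀) hcS
  simp only [Complex.ofReal_neg, mul_neg] at key
  exact key

/-- Reflection, k → -k and λ → -λ combined. -/
theorem jost_psiBar (hθ : ∃ n : ℤ, θp + θm = n * (2 * Real.pi))
    (hpot : PotentialCondition q₀ α θp θm q t S) (hS : S ⊆ closedLowerSheet q₀)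
    (hcS : ∀ k ∈ (cut q₀)ᶜ, (k, lam₂ q₀ k) ∈ S) :
    (∀ P ∈ S, ∃! φ, IsPsiBar q₀ α θm q t P φ) ∧ ∀ x, ContinuousOn (NBar q₀ α θm q t x) S ∧
      AnalyticOnNhd ℂ (fun k => NBar q₀ α θm q t x (k, lam₂ q₀ k)) (cut q₀)ᶜ := by
  have hab : -qInf q₀ α θp t * -qInf q₀ α θm (-t) = (q₀ : ℂ) ^ 2 := by
    rw [neg_mul_neg]
    exact qInf_mul_qInf q₀ α t hθ
  have hcurve : ∀ P ∈ S, P.2 ^ 2 = P.1 ^ 2 - (q₀ : ℂ) ^ 2 := fun P hP =>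
    (closedLowerSheet_subset q₀ (hS hP)).1
  have key := existsUnique_continuousOn_analyticOnNhd (κ := fun P => -P.1) (l := fun P => -P.2)
    (w := fun P => ![P.2 + P.1, Complex.I * qInf q₀ α θm (-t)]) differentiable_fst.neg
    differentiable_snd.neg (differentiable_vecCons (by fun_prop) (by fun_prop))
    (fun P hP => by rw [hab, neg_sq, neg_sq]; exact hcurve P hP)
    (fun P hP => by
      rw [Complex.neg_im, neg_nonneg]
      exact (closedLowerSheet_subset q₀ (hS hP)).2)
    (fun P hP => by
      simp only [Matrix.cons_val_zero, Matrix.cons_val_one]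
      linear_combination -Complex.I * hcurve P hP - Complex.I * hab)
    (fun P hP => by
      simp only [Matrix.cons_val_zero, Matrix.cons_val_one]
      linear_combination -(P.2 + P.1) * qInf q₀ α θm (-t) * Complex.I_sq)
    (hpot.admissible_right fun P hP => neg_ne_zero.2 hP) (s := Neg.neg) neg_neg
    (Is := IsPsiBar q₀ α θm q t)
    (fun P φ => by
      rw [isOffDiagSolution_comp_neg_iff (p := fun x => q x t) (r := fun x => q (-x) (-t)),
        IsPsiBar, tendsto_atTop_iff_comp_neg_atBot]
      simp only [Complex.ofReal_neg, mul_neg, neg_mul]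
      exact Iff.rfl)
    (isOpen_compl_cut q₀) (differentiableOn_lowerSheet_section q₀) hcS
  simp only [Complex.ofReal_neg, mul_neg, neg_mul, neg_neg] at key
  exact key

end Potential

end NonlocalSinhGordon

theorem theorem1 (q₀ α θp θm : ℝ) (hq₀ : 0 < q₀)
    (hθ : ∃ n : ℤ, θp + θm = n * (2 * Real.pi))
    (q : ℝ → ℝ → ℂ) (t : ℝ) :
    (PotentialL1 q₀ α θp θm q t →
      (∀ P ∈ closedUpperSheet q₀ \ branchPoints q₀,
        (∃! φ, IsPhi q₀ α θp q t P φ) ∧ (∃! ψ, IsPsi q₀ α θp q t P ψ)) ∧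
      (∀ P ∈ closedLowerSheet q₀ \ branchPoints q₀,
        (∃! φ, IsPhiBar q₀ α θm q t P φ) ∧ (∃! ψ, IsPsiBar q₀ α θm q t P ψ)) ∧
      ∀ x : ℝ,
        (ContinuousOn (M q₀ α θp q t x) (closedUpperSheet q₀ \ branchPoints q₀) ∧
          AnalyticOnNhd ℂ (fun k => M q₀ α θp q t x (k, lam₁ q₀ k)) (cut q₀)ᶜ) ∧
        (ContinuousOn (N q₀ α θp q t x) (closedUpperSheet q₀ \ branchPoints q₀) ∧
          AnalyticOnNhd ℂ (fun k => N q₀ α θp q t x (k, lam₁ q₀ k)) (cut q₀)ᶜ) ∧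
        (ContinuousOn (MBar q₀ α θm q t x) (closedLowerSheet q₀ \ branchPoints q₀) ∧
          AnalyticOnNhd ℂ (fun k => MBar q₀ α θm q t x (k, lam₂ q₀ k)) (cut q₀)ᶜ) ∧
        (ContinuousOn (NBar q₀ α θm q t x) (closedLowerSheet q₀ \ branchPoints q₀) ∧
          AnalyticOnNhd ℂ (fun k => NBar q₀ α θm q t x (k, lam₂ q₀ k)) (cut q₀)ᶜ)) ∧
    (PotentialL12 q₀ α θp θm q t →
      (∀ P ∈ closedUpperSheet q₀,
        (∃! φ, IsPhi q₀ α θp q t P φ) ∧ (∃! ψ, IsPsi q₀ α θp q t P ψ)) ∧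
      (∀ P ∈ closedLowerSheet q₀,
        (∃! φ, IsPhiBar q₀ α θm q t P φ) ∧ (∃! ψ, IsPsiBar q₀ α θm q t P ψ)) ∧
      ∀ x : ℝ,
        (ContinuousOn (M q₀ α θp q t x) (closedUpperSheet q₀) ∧
          AnalyticOnNhd ℂ (fun k => M q₀ α θp q t x (k, lam₁ q₀ k)) (cut q₀)ᶜ) ∧
        (ContinuousOn (N q₀ α θp q t x) (closedUpperSheet q₀) ∧
          AnalyticOnNhd ℂ (fun k => N q₀ α θp q t x (k, lam₁ q₀ k)) (cut q₀)ᶜ) ∧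
        (ContinuousOn (MBar q₀ α θm q t x) (closedLowerSheet q₀) ∧
          AnalyticOnNhd ℂ (fun k => MBar q₀ α θm q t x (k, lam₂ q₀ k)) (cut q₀)ᶜ) ∧
        (ContinuousOn (NBar q₀ α θm q t x) (closedLowerSheet q₀) ∧
          AnalyticOnNhd ℂ (fun k => NBar q₀ α θm q t x (k, lam₂ q₀ k)) (cut q₀)ᶜ)) := by
  -- Off the branch points λ ≠ 0, so plain integrability of the potential suffices in (i).
  have hu : ∀ P ∈ closedUpperSheet q₀ \ branchPoints q₀, P.2 ≠ 0 := fun P hP h0 =>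
    hP.2 (mem_branchPoints_of_snd_eq_zero (closedUpperSheet_subset q₀ hP.1).1 h0)
  have hl : ∀ P ∈ closedLowerSheet q₀ \ branchPoints q₀, P.2 ≠ 0 := fun P hP h0 =>
    hP.2 (mem_branchPoints_of_snd_eq_zero (closedLowerSheet_subset q₀ hP.1).1 h0)
  refine ⟨fun h => ?_, fun h => ?_⟩
  · have hu' : PotentialCondition q₀ α θp θm q t (closedUpperSheet q₀ \ branchPoints q₀) :=
      ⟨h, Or.inl hu⟩
    have hl' : PotentialCondition q₀ α θp θm q t (closedLowerSheet q₀ \ branchPoints q₀) :=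
      ⟨h, Or.inl hl⟩
    have hcu : ∀ k ∈ (cut q₀)ᶜ, (k, lam₁ q₀ k) ∈ closedUpperSheet q₀ \ branchPoints q₀ :=
      fun k hk => ⟨mem_closedUpperSheet hk, notMem_branchPoints hk⟩
    have hcl : ∀ k ∈ (cut q₀)ᶜ, (k, lam₂ q₀ k) ∈ closedLowerSheet q₀ \ branchPoints q₀ :=
      fun k hk => ⟨mem_closedLowerSheet hk, notMem_branchPoints hk⟩
    obtain ⟨h1, h1'⟩ := jost_phi hθ hu' sdiff_subset hcu
    obtain ⟨h2, h2'⟩ := jost_psi hθ hu' sdiff_subset hcu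
    obtain ⟨h3, h3'⟩ := jost_phiBar hθ hl' sdiff_subset hcl
    obtain ⟨h4, h4'⟩ := jost_psiBar hθ hl' sdiff_subset hcl
    exact ⟨fun P hP => ⟨h1 P hP, h2 P hP⟩, fun P hP => ⟨h3 P hP, h4 P hP⟩,
      fun x => ⟨h1' x, h2' x, h3' x, h4' x⟩⟩
  · have hu' : PotentialCondition q₀ α θp θm q t (closedUpperSheet q₀) :=
      ⟨h.potentialL1, Or.inr h⟩
    have hl' : PotentialCondition q₀ α θp θm q t (closedLowerSheet q₀) :=
      ⟨h.potentialL1, Or.inr h⟩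
    obtain ⟨h1, h1'⟩ := jost_phi hθ hu' subset_rfl fun k hk => mem_closedUpperSheet hk
    obtain ⟨h2, h2'⟩ := jost_psi hθ hu' subset_rfl fun k hk => mem_closedUpperSheet hk
    obtain ⟨h3, h3'⟩ := jost_phiBar hθ hl' subset_rfl fun k hk => mem_closedLowerSheet hk
    obtain ⟨h4, h4'⟩ := jost_psiBar hθ hl' subset_rfl fun k hk => mem_closedLowerSheet hk
    exact ⟨fun P hP => ⟨h1 P hP, h2 P hP⟩, fun P hP => ⟨h3 P hP, h4 P hP⟩,
      fun x => ⟨h1' x, h2' x, h3' x, h4' x⟩⟩
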